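/- Let $q\ge 2$ and let $\Delta$ be a homogeneous tree of degree $q+1$. Let $\partial\Delta$ be its boundary, that is, the set of equivalence classes of infinite semi-geodesics in $\Delta$, where two semi-geodesics are equivalent if they contain a common sub-semi-geodesic. Fix a vertex $O$ of $\Delta$, and for a vertex $v$ let $\Omega_v\subseteq\partial\Delta$ be the set of all $\omega\in\partial\Delta$ such that $v$ lies on the semi-geodesic $[O,\omega)$ from $O$ in the class $\omega$. Give $\partial\Delta$ the topology generated by the sets $\Omega_v$, and let $\mu$ be the Borel measure on $\partial\Delta$ such that $\mu(\Omega_v)=q^{1-d(O,v)}$ for all vertices $v\neq O$, where $d$ is the graph distance. Let $\Gamma$ be a free uniform lattice in $\operatorname{Aut}(\Delta)$, that is, a discrete subgroup (for the compact-open topology) no nontrivial element of which stabilizes a vertex or a geometric edge of $\Delta$, and for which the quotient graph $\Gamma\backslash\Delta$ is finite. Let $[\Gamma]$ be the full group of the action of $\Gamma$ on $(\partial\Delta,\mu)$, that is, the group of all bimeasurable bijections $T$ of $\partial\Delta$ which preserve the class of $\mu$-null sets and satisfy $T\omega\in\Gamma\omega$ for $\mu$-almost every $\omega\in\partial\Delta$.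 Then $[\Gamma]$ contains a subgroup $H$ such that every element of $H$ preserves $\mu$ and $H$ acts ergodically on $(\partial\Delta,\mu)$: every Borel set $S\subseteq\partial\Delta$ with $\mu(h^{-1}S\,\triangle\, S)=0$ for all $h\in H$ satisfies $\mu(S)=0$ or $\mu(\partial\Delta\setminus S)=0$. -/

import Mathlib

open MeasureTheory
open scoped ENNReal

namespace TreeBoundary

universe u

/-! ### The boundary of a tree -/

section Boundary

variable {V : Type u} (G : SimpleGraph V)

/-- An infinite semi-geodesic: an isometric embedding of `ℕ` into the vertices of the graph. -/
@[ext]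
structure Ray : Type u where
  vertex : ℕ → V
  dist_eq : ∀ m k : ℕ, G.dist (vertex m) (vertex (m + k)) = k

/-- Two semi-geodesics are equivalent if they contain a common sub-semi-geodesic. -/
def raySetoid : Setoid (Ray G) where
  r x y := ∃ m n : ℕ, ∀ k : ℕ, x.vertex (m + k) = y.vertex (n + k)
  iseqv :=
    { refl := fun _ => ⟨0, 0, fun _ => rfl⟩
      symm := fun ⟨m, n, h⟩ => ⟨n, m, fun k => (h k).symm⟩
      trans := by
        rintro x y z ⟨m, n, h⟩ ⟨m', n', h'⟩
        refine ⟨m + m', n' + n, fun k => ?_⟩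
        rw [add_assoc, h (m' + k), add_assoc, ← h' (n + k)]
        congr 1
        ring }

/-- The boundary `∂Δ` of the tree `Δ = G`, the set of equivalence classes of semi-geodesics.
The base vertex `O` does not enter the set; it is recorded because the topology and the measure
below are described by means of it. -/
def Boundary (_O : V) : Type u := Quotient (raySetoid G)

variable {G}

/-- The image of a semi-geodesic under an automorphism of the tree. -/
def Ray.map (g : G ≃g G) (x : Ray G) : Ray G :=
  ⟨fun n => g (x.vertex n), fun m k => by
    have hle : ∀ (f : G ≃g G) (a b : V), G.dist a b ≠ 0 → G.dist (f a) (f b) ≤ G.dist a b := by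
      intro f a b h
      obtain ⟨p, hp⟩ := SimpleGraph.exists_walk_of_dist_ne_zero h
      rw [← hp, ← SimpleGraph.Walk.length_map f.toHom p]
      exact SimpleGraph.dist_le _
    have hx := x.dist_eq m k
    rcases Nat.eq_zero_or_pos k with rfl | hk
    · simp
    · have h1 := hle g _ _ (by rw [hx]; omega)
      have hne : G.dist (g (x.vertex m)) (g (x.vertex (m + k))) ≠ 0 := by
        obtain ⟨hab, hr⟩ := SimpleGraph.dist_ne_zero_iff_ne_and_reachable.1
          (show G.dist (x.vertex m) (x.vertex (m + k)) ≠ 0 by rw [hx]; omega)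
        exact SimpleGraph.dist_ne_zero_iff_ne_and_reachable.2
          ⟨fun h => hab (g.injective h), hr.map g.toHom⟩
      have h2 := hle g.symm _ _ hne
      simp only [RelIso.symm_apply_apply] at h2
      exact (h1.trans_eq hx).antisymm (hx.symm.le.trans h2)⟩

/-- The action of the automorphism group of the tree on the boundary. -/
instance (O : V) : MulAction (G ≃g G) (Boundary G O) where
  smul g := Quotient.map (Ray.map g) (by
    rintro x y ⟨m, n, h⟩
    exact ⟨m, n, fun k => congrArg g (h k)⟩)
  one_smul := by rintro ⟨x⟩; rfl
  mul_smul g h := by rintro ⟨x⟩; rfl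

/-- The class `ω` of a semi-geodesic. -/
def Boundary.mk (O : V) (x : Ray G) : Boundary G O := Quotient.mk (raySetoid G) x

variable (G)

/-- `Ω_v`: the boundary points `ω` such that `v` lies on the semi-geodesic `[O, ω)`. -/
def shadow (O v : V) : Set (Boundary G O) :=
  {ω | ∃ x : Ray G, Boundary.mk O x = ω ∧ x.vertex 0 = O ∧ ∃ n, x.vertex n = v}

/-- The topology of the boundary: the sets `Ω_v` are the basic open sets. -/
instance (O : V) : TopologicalSpace (Boundary G O) :=
  TopologicalSpace.generateFrom (Set.range (shadow G O))

instance (O : V) : MeasurableSpace (Boundary G O) := borel _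

instance (O : V) : BorelSpace (Boundary G O) := ⟨rfl⟩

end Boundary

/-! ### Combinatorics of rooted trees needed for the construction of the measure -/

section Tree

variable {V : Type u} {G : SimpleGraph V}

lemma parent_unique (hG : G.IsTree) {O u u' v : V} (h : G.Adj u v) (h' : G.Adj u' v)
    (hd : G.dist O v = G.dist O u + 1) (hd' : G.dist O v = G.dist O u' + 1) : u = u' := by
  obtain ⟨p, hp⟩ := hG.connected.exists_walk_length_eq_dist O u
  obtain ⟨p', hp'⟩ := hG.connected.exists_walk_length_eq_dist O u'
  have h1 : (p.concat h).IsPath := SimpleGraph.Walk.isPath_of_length_eq_dist _ (by simp [hp, hd])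
  have h2 : (p'.concat h').IsPath :=
    SimpleGraph.Walk.isPath_of_length_eq_dist _ (by simp [hp', hd'])
  have := (hG.existsUnique_path O v).unique h1 h2
  have h3 := congrArg SimpleGraph.Walk.penultimate this
  simpa using h3

lemma countable_of_locallyFinite (hG : G.Connected) [G.LocallyFinite] (O : V) : Countable V := by
  have hfin : ∀ n : ℕ, {v | G.dist O v = n}.Countable := by
    intro n
    induction n with
    | zero =>
      refine (Set.countable_singleton O).mono fun v hv => ?_
      exact ((hG.dist_eq_zero_iff).1 hv).symm
    | succ n ih =>
      refine (ih.biUnion fun u _ => (G.neighborSet u).toFinite.countable).mono fun v hv => ?_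
      obtain ⟨p, hp⟩ := hG.exists_walk_length_eq_dist v O
      cases p with
      | nil => simp at hv
      | @cons _ u _ hadj p =>
        simp only [Set.mem_ofPred_eq] at hv
        rw [G.dist_comm, hv, SimpleGraph.Walk.length_cons] at hp
        have h1 := SimpleGraph.dist_le p
        have h2 := hG.dist_triangle (u := O) (v := u) (w := v)
        rw [SimpleGraph.dist_eq_one_iff_adj.2 hadj.symm] at h2
        rw [G.dist_comm] at h1
        exact Set.mem_biUnion (x := u) (show G.dist O u = n by omega) hadj.symm
  have : (Set.univ : Set V).Countable :=
    (Set.countable_iUnion hfin).mono fun v _ => Set.mem_iUnion.2 ⟨G.dist O v, rfl⟩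
  exact Set.countable_univ_iff.1 this

/-- The neighbours of `v` that are farther from `O` than `v` is. -/
noncomputable def children [G.LocallyFinite] (O v : V) : Finset V :=
  open Classical in (G.neighborFinset v).filter fun w => G.dist O w = G.dist O v + 1

lemma mem_children [G.LocallyFinite] {O v w : V} :
    w ∈ children (G := G) O v ↔ G.Adj v w ∧ G.dist O w = G.dist O v + 1 := by
  simp [children]

lemma card_children (hG : G.IsTree) [G.LocallyFinite] {q : ℕ}
    (hreg : G.IsRegularOfDegree (q + 1)) {O v : V} (hv : v ≠ O) :
    (children (G := G) O v).card = q := by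
  classical
  obtain ⟨u, hu, hdu⟩ : ∃ u, G.Adj v u ∧ G.dist O v = G.dist O u + 1 := by
    obtain ⟨p, hp⟩ := hG.connected.exists_walk_length_eq_dist v O
    cases p with
    | nil => exact absurd rfl hv
    | @cons _ u _ hadj p =>
      refine ⟨u, hadj, ?_⟩
      rw [G.dist_comm, SimpleGraph.Walk.length_cons] at hp
      have h1 := SimpleGraph.dist_le p
      rw [G.dist_comm] at h1
      have h2 := hG.connected.dist_triangle (u := O) (v := u) (w := v)
      rw [SimpleGraph.dist_eq_one_iff_adj.2 hadj.symm] at h2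
      omega
  have hE : children (G := G) O v = (G.neighborFinset v).erase u := by
    ext w
    rw [mem_children, Finset.mem_erase, SimpleGraph.mem_neighborFinset]
    constructor
    · rintro ⟨hw, hd⟩
      refine ⟨?_, hw⟩
      rintro rfl
      omega
    · rintro ⟨hne, hw⟩
      refine ⟨hw, ?_⟩
      rcases hG.dist_eq_dist_add_one_of_adj O hw with h | h
      · exact absurd (parent_unique hG hw.symm hu.symm h hdu) hne
      · exact h
  rw [hE, Finset.card_erase_of_mem (by simpa using hu), SimpleGraph.card_neighborFinset_eq_degree,
    hreg v]
  rfl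

namespace Ray

lemma adj (x : Ray G) (n : ℕ) : G.Adj (x.vertex n) (x.vertex (n + 1)) :=
  SimpleGraph.dist_eq_one_iff_adj.1 (x.dist_eq n 1)

lemma dist_base {O : V} (x : Ray G) (h : x.vertex 0 = O) (n : ℕ) : G.dist O (x.vertex n) = n := by
  have := x.dist_eq 0 n
  rwa [h, zero_add] at this

lemma eq_of_eq (hG : G.IsTree) {O : V} {x y : Ray G} (hx : x.vertex 0 = O) (hy : y.vertex 0 = O) {n : ℕ}
    (h : x.vertex n = y.vertex n) : ∀ k ≤ n, x.vertex k = y.vertex k := by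
  induction n with
  | zero => intro k hk; rwa [Nat.le_zero.1 hk]
  | succ n ih =>
    intro k hk
    rcases Nat.lt_or_eq_of_le hk with hk | rfl
    · refine ih ?_ k (by omega)
      have h1 := x.adj n
      have h2 := y.adj n
      rw [← h] at h2
      refine parent_unique hG (O := O) h1 h2 ?_ ?_
      · rw [x.dist_base hx, x.dist_base hx]
      · rw [x.dist_base hx, y.dist_base hy]
    · exact h

lemma unique (hG : G.IsTree) {O : V} {x y : Ray G} (hx : x.vertex 0 = O) (hy : y.vertex 0 = O)
    (h : Boundary.mk O x = Boundary.mk O y) : x = y := by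
  obtain ⟨m, n, hmn⟩ : ∃ m n : ℕ, ∀ k : ℕ, x.vertex (m + k) = y.vertex (n + k) := Quotient.exact h
  have hmn' : m = n := by
    have := congrArg (G.dist O) (hmn 0)
    simpa [x.dist_base hx, y.dist_base hy] using this
  subst hmn'
  ext k
  exact eq_of_eq hG hx hy (hmn k) k (by omega)

lemma mem_shadow (hG : G.IsTree) {O : V} {x : Ray G} (hx : x.vertex 0 = O) {v : V} :
    Boundary.mk O x ∈ shadow G O v ↔ x.vertex (G.dist O v) = v := by
  constructor
  · rintro ⟨y, hyx, hy, n, rfl⟩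
    rw [unique hG hx hy hyx.symm, y.dist_base hy]
  · intro h
    exact ⟨x, rfl, hx, _, h⟩

/-- A sequence of adjacent vertices that moves away from its origin is a semi-geodesic. -/
lemma exists_of_dist (hG : G.IsTree) {O : V} (x : ℕ → V)
    (ha : ∀ n, G.Adj (x n) (x (n + 1))) (hd : ∀ n, G.dist O (x n) = n) :
    ∃ r : Ray G, r.vertex = x := by
  refine ⟨⟨x, fun m k => le_antisymm ?_ ?_⟩, rfl⟩
  · induction k with
    | zero => simp
    | succ k ih =>
      have h1 := hG.connected.dist_triangle (u := x m) (v := x (m + k)) (w := x (m + k + 1))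
      rw [SimpleGraph.dist_eq_one_iff_adj.2 (ha (m + k))] at h1
      rw [← add_assoc]
      omega
  · have h1 := hG.connected.dist_triangle (u := O) (v := x m) (w := x (m + k))
    rw [hd, hd] at h1
    omega

end Ray

lemma exists_ray_of_mem {O v : V} {ω : Boundary G O} (h : ω ∈ shadow G O v) :
    ∃ x : Ray G, Boundary.mk O x = ω ∧ x.vertex 0 = O := by
  obtain ⟨x, hx, h0, -⟩ := h
  exact ⟨x, hx, h0⟩

lemma shadow_subset_of_mem (hG : G.IsTree) {O v w : V} (hd : G.dist O w ≤ G.dist O v)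
    {ω : Boundary G O} (hv : ω ∈ shadow G O v) (hw : ω ∈ shadow G O w) :
    shadow G O v ⊆ shadow G O w := by
  intro ω' hω'
  obtain ⟨x, rfl, hx⟩ := exists_ray_of_mem hv
  obtain ⟨y, rfl, hy⟩ := exists_ray_of_mem hω'
  rw [Ray.mem_shadow hG hx] at hv hw
  rw [Ray.mem_shadow hG hy] at hω' ⊢
  rw [← Ray.eq_of_eq hG hx hy (hv.trans hω'.symm) _ hd, hw]

lemma shadow_subset_children (hG : G.IsTree) [G.LocallyFinite] (O v : V) :
    shadow G O v ⊆ ⋃ c ∈ children (G := G) O v, shadow G O c := by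
  intro ω hω
  obtain ⟨x, rfl, hx⟩ := exists_ray_of_mem hω
  rw [Ray.mem_shadow hG hx] at hω
  refine Set.mem_biUnion (x := x.vertex (G.dist O v + 1)) ?_ ?_
  · refine mem_children.2 ⟨?_, x.dist_base hx _⟩
    have := x.adj (G.dist O v)
    rwa [hω] at this
  · rw [Ray.mem_shadow hG hx, x.dist_base hx]

lemma children_ne [G.LocallyFinite] {O v c : V} (hc : c ∈ children (G := G) O v) : c ≠ O := by
  rintro rfl
  have := (mem_children.1 hc).2
  simp at this

lemma shadow_child_subset (hG : G.IsTree) [G.LocallyFinite] {O v c : V}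
    (hc : c ∈ children (G := G) O v) : shadow G O c ⊆ shadow G O v := by
  intro ω hω
  obtain ⟨x, rfl, hx⟩ := exists_ray_of_mem hω
  obtain ⟨hadj, hd⟩ := mem_children.1 hc
  rw [Ray.mem_shadow hG hx] at hω ⊢
  have h1 := x.adj (G.dist O v)
  rw [← hd, hω] at h1
  exact parent_unique hG (O := O) h1 hadj (by rw [x.dist_base hx, hd]) hd

end Tree

/-! ### The natural Borel measure on the boundary of a homogeneous tree -/

section Measure

variable {V : Type u} (G : SimpleGraph V)

/-- The value `q ^ (1 - n)`, `n = d(O, v)`, of the measure on `Ω_v`, for `v ≠ O`, as a function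
on all sets (which is `∞` on sets that are not of this form). -/
noncomputable def cylinderWeight (q : ℕ) (O : V) (A : Set (Boundary G O)) : ℝ≥0∞ :=
  ⨅ (v : V) (_ : v ≠ O) (_ : A = shadow G O v), (q : ℝ≥0∞) ^ (1 - (G.dist O v : ℤ))

/-- The outer measure obtained by covering with countably many sets `Ω_v`. -/
noncomputable def boundaryOuterMeasure (q : ℕ) (O : V) : OuterMeasure (Boundary G O) :=
  OuterMeasure.boundedBy (cylinderWeight G q O)

variable {G}

lemma boundaryOuterMeasure_shadow_le (q : ℕ) {O v : V} (hv : v ≠ O) :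
    boundaryOuterMeasure G q O (shadow G O v) ≤ (q : ℝ≥0∞) ^ (1 - (G.dist O v : ℤ)) :=
  (OuterMeasure.boundedBy_le _).trans
    (iInf_le_of_le v (iInf_le_of_le hv (iInf_le_of_le rfl le_rfl)))

lemma sum_children_weight (hG : G.IsTree) [G.LocallyFinite] {q : ℕ} (hq : q ≠ 0)
    (hreg : G.IsRegularOfDegree (q + 1)) {O v : V} (hv : v ≠ O) :
    ∑ c ∈ children (G := G) O v, (q : ℝ≥0∞) ^ (1 - (G.dist O c : ℤ))
      = (q : ℝ≥0∞) ^ (1 - (G.dist O v : ℤ)) := by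
  have h1 : ∀ c ∈ children (G := G) O v, (q : ℝ≥0∞) ^ (1 - (G.dist O c : ℤ))
      = (q : ℝ≥0∞) ^ (-(G.dist O v : ℤ)) := by
    intro c hc
    rw [(mem_children.1 hc).2]
    congr 1
    push_cast
    ring
  rw [Finset.sum_congr rfl h1, Finset.sum_const, card_children hG hreg hv, nsmul_eq_mul,
    sub_eq_add_neg, ENNReal.zpow_add (by exact_mod_cast hq) (ENNReal.natCast_ne_top q), zpow_one]

lemma borel_le_caratheodory (hG : G.IsTree) [G.LocallyFinite] {q : ℕ} (hq : q ≠ 0)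
    (hreg : G.IsRegularOfDegree (q + 1)) (O : V) :
    (inferInstance : MeasurableSpace (Boundary G O))
      ≤ (boundaryOuterMeasure G q O).caratheodory := by
  have hc : Countable V := countable_of_locallyFinite hG.connected O
  have hsc : SecondCountableTopology (Boundary G O) := ⟨_, Set.countable_range (shadow G O), rfl⟩
  have hb : (inferInstance : MeasurableSpace (Boundary G O))
      = MeasurableSpace.generateFrom (Set.range (shadow G O)) :=
    borel_eq_generateFrom_of_subbasis rfl
  rw [hb]
  refine MeasurableSpace.generateFrom_le ?_
  rintro _ ⟨w, rfl⟩
  set s := shadow G O w with hs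
  set μ := boundaryOuterMeasure G q O with hμ
  set ν : OuterMeasure (Boundary G O) :=
    OuterMeasure.restrict s μ + OuterMeasure.restrict sᶜ μ with hν
  have hνa : ∀ t, ν t = μ (t ∩ s) + μ (t \ s) := by
    intro t
    simp [hν, Set.sdiff_eq]
  rw [OuterMeasure.isCaratheodory_iff_le]
  intro t
  rw [← hνa]
  suffices h : ν ≤ boundaryOuterMeasure G q O from h t
  refine OuterMeasure.le_boundedBy.2 fun A => ?_
  refine le_iInf fun v => le_iInf fun hv => le_iInf fun hA => ?_
  subst hA
  have key : ∀ (k : ℕ) (v : V), v ≠ O → G.dist O w ≤ G.dist O v + k →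
      ν (shadow G O v) ≤ (q : ℝ≥0∞) ^ (1 - (G.dist O v : ℤ)) := by
    intro k
    induction k with
    | zero =>
      intro v hv hd
      rw [hνa]
      rcases (shadow G O v ∩ s).eq_empty_or_nonempty with he | ⟨ω, h1, h2⟩
      · rw [he, measure_empty, zero_add]
        exact (measure_mono Set.sdiff_subset).trans (boundaryOuterMeasure_shadow_le q hv)
      · rw [Set.sdiff_eq_empty.2 (shadow_subset_of_mem hG hd h1 h2), measure_empty, add_zero]
        exact (measure_mono Set.inter_subset_left).trans (boundaryOuterMeasure_shadow_le q hv)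
    | succ k ih =>
      intro v hv hd
      calc ν (shadow G O v)
          ≤ ν (⋃ c ∈ children (G := G) O v, shadow G O c) :=
            measure_mono (shadow_subset_children hG O v)
        _ ≤ ∑ c ∈ children (G := G) O v, ν (shadow G O c) := measure_biUnion_finset_le _ _
        _ ≤ ∑ c ∈ children (G := G) O v, (q : ℝ≥0∞) ^ (1 - (G.dist O c : ℤ)) := by
            refine Finset.sum_le_sum fun c hc => ih c (children_ne hc) ?_
            rw [(mem_children.1 hc).2]
            omega
        _ = _ := sum_children_weight hG hq hreg hv
  exact key (G.dist O w) v hv (by omega)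

/-- The natural Borel measure `μ` on the boundary of a homogeneous tree of degree `q + 1`; it is
determined by its values `μ (Ω_v) = q ^ (1 - d(O, v))`, `v ≠ O`
(see `boundaryMeasure_shadow`). -/
noncomputable def boundaryMeasure (hG : G.IsTree) [G.LocallyFinite] {q : ℕ} (hq : q ≠ 0)
    (hreg : G.IsRegularOfDegree (q + 1)) (O : V) : Measure (Boundary G O) :=
  (boundaryOuterMeasure G q O).toMeasure (borel_le_caratheodory hG hq hreg O)

/-- Extend the geodesic from `O` to `v` by a sequence of vertices moving away from `O`. -/
lemma exists_ray_extending (hG : G.IsTree) {O v : V} (w : ℕ → V) (h0 : w 0 = v)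
    (ha : ∀ n, G.Adj (w n) (w (n + 1))) (hd : ∀ n, G.dist O (w n) = G.dist O v + n) :
    ∃ x : Ray G, x.vertex 0 = O ∧ ∀ n, x.vertex (G.dist O v + n) = w n := by
  obtain ⟨p, hp⟩ := hG.connected.exists_walk_length_eq_dist O v
  set N := G.dist O v with hN
  have hpd : ∀ i ≤ N, G.dist O (p.getVert i) = i := by
    intro i hi
    refine le_antisymm ?_ ?_
    · refine (SimpleGraph.dist_le (p.take i)).trans ?_
      simp
    · have h1 := SimpleGraph.dist_le (p.drop i)
      rw [SimpleGraph.Walk.drop_length] at h1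
      have h2 := hG.connected.dist_triangle (u := O) (v := p.getVert i) (w := v)
      omega
  set x : ℕ → V := fun i => if i ≤ N then p.getVert i else w (i - N) with hx
  have hxw : ∀ n, x (N + n) = w n := by
    intro n
    rcases Nat.eq_zero_or_pos n with rfl | hn
    · simp [hx, h0, ← hp]
    · simp [hx, show ¬ n = 0 by omega]
  have hxp : ∀ i ≤ N, x i = p.getVert i := fun i hi => by simp [hx, hi]
  obtain ⟨r, hr⟩ := Ray.exists_of_dist hG (O := O) x (by
    intro i
    rcases lt_or_ge i N with hi | hi
    · rw [hxp i hi.le, hxp (i + 1) hi]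
      exact p.adj_getVert_succ (by omega)
    · obtain ⟨k, rfl⟩ := Nat.exists_eq_add_of_le hi
      rw [hxw, add_assoc, hxw]
      exact ha k) (by
    intro i
    rcases lt_or_ge i N with hi | hi
    · rw [hxp i hi.le, hpd i hi.le]
    · obtain ⟨k, rfl⟩ := Nat.exists_eq_add_of_le hi
      rw [hxw, hd])
  refine ⟨r, ?_, fun n => ?_⟩
  · rw [hr, hxp 0 (Nat.zero_le _)]
    simp
  · rw [hr, hxw]

/-- Covers of `Ω_v` by countably many sets of the same kind do not have smaller total weight. -/
lemma weight_le_tsum (hG : G.IsTree) [G.LocallyFinite] {q : ℕ} (hq : q ≠ 0)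
    (hreg : G.IsRegularOfDegree (q + 1)) {O v : V} (hv : v ≠ O) {ι : Type} (u : ι → V)
    (hcov : shadow G O v ⊆ ⋃ i, shadow G O (u i)) :
    (q : ℝ≥0∞) ^ (1 - (G.dist O v : ℤ)) ≤ ∑' i, (q : ℝ≥0∞) ^ (1 - (G.dist O (u i) : ℤ)) := by
  classical
  by_contra! hlt
  set W : V → ℝ≥0∞ := fun v => (q : ℝ≥0∞) ^ (1 - (G.dist O v : ℤ)) with hW
  let P : V → ι → Prop := fun w i =>
    (shadow G O (u i)).Nonempty ∧ shadow G O (u i) ⊆ shadow G O w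
  let F : V → ℝ≥0∞ := fun w => ∑' i, if P w i then W (u i) else 0
  have hstep : ∀ w, w ≠ O → F w < W w →
      ∃ c ∈ children (G := G) O w, F c < W c := by
    intro w hw hF
    by_contra! hcon
    refine absurd hF (not_lt.2 ?_)
    calc W w = ∑ c ∈ children (G := G) O w, W c := (sum_children_weight hG hq hreg hw).symm
      _ ≤ ∑ c ∈ children (G := G) O w, F c := Finset.sum_le_sum hcon
      _ = ∑' i, ∑ c ∈ children (G := G) O w, (if P c i then W (u i) else 0) :=
          (Summable.tsum_finsetSum fun _ _ => ENNReal.summable).symm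
      _ ≤ F w := by
          refine ENNReal.tsum_le_tsum fun i => ?_
          by_cases hex : ∃ c ∈ children (G := G) O w, P c i
          · obtain ⟨c, hc, hPc⟩ := hex
            rw [Finset.sum_eq_single_of_mem c hc, if_pos hPc,
              if_pos ⟨hPc.1, hPc.2.trans (shadow_child_subset hG hc)⟩]
            intro c' hc' hne
            rw [if_neg]
            intro hPc'
            obtain ⟨ω, hω⟩ := hPc.1
            have h1 := hPc.2 hω
            have h2 := hPc'.2 hω
            obtain ⟨x, rfl, hx⟩ := exists_ray_of_mem hω
            rw [Ray.mem_shadow hG hx] at h1 h2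
            rw [(mem_children.1 hc).2] at h1
            rw [(mem_children.1 hc').2] at h2
            exact hne (h2.symm.trans h1)
          · push Not at hex
            rw [Finset.sum_eq_zero fun c hc => if_neg (hex c hc)]
            exact zero_le
  choose! f hfc hfF using hstep
  let w : ℕ → V := fun n => f^[n] v
  have hw : ∀ n, w n ≠ O ∧ F (w n) < W (w n) := by
    intro n
    induction n with
    | zero =>
      refine ⟨hv, lt_of_le_of_lt (ENNReal.tsum_le_tsum fun i => ?_) hlt⟩
      split_ifs
      · exact le_rfl
      · exact zero_le
    | succ n ih =>
      have h1 : w (n + 1) = f (w n) := Function.iterate_succ_apply' f n v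
      rw [h1]
      exact ⟨children_ne (hfc _ ih.1 ih.2), hfF _ ih.1 ih.2⟩
  have hwc : ∀ n, w (n + 1) ∈ children (G := G) O (w n) := by
    intro n
    have h1 : w (n + 1) = f (w n) := Function.iterate_succ_apply' f n v
    rw [h1]
    exact hfc _ (hw n).1 (hw n).2
  have hwd : ∀ n, G.dist O (w n) = G.dist O v + n := by
    intro n
    induction n with
    | zero => rfl
    | succ n ih => rw [(mem_children.1 (hwc n)).2, ih, add_assoc]
  obtain ⟨x, hx0, hxw⟩ := exists_ray_extending hG (v := v) w rfl (fun n => (mem_children.1 (hwc n)).1) hwd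
  have hxv : Boundary.mk O x ∈ shadow G O v := by
    rw [Ray.mem_shadow hG hx0]
    exact hxw 0
  obtain ⟨i, hi⟩ := Set.mem_iUnion.1 (hcov hxv)
  have hui := (Ray.mem_shadow hG hx0).1 hi
  rcases le_or_gt (G.dist O v) (G.dist O (u i)) with hle | hgt
  · obtain ⟨k, hk⟩ := Nat.exists_eq_add_of_le hle
    rw [hk, hxw] at hui
    refine absurd (hw k).2 (not_lt.2 ?_)
    have hP : P (w k) i := ⟨⟨_, hi⟩, by rw [hui]⟩
    calc W (w k) = if P (w k) i then W (u i) else 0 := by rw [if_pos hP, hui]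
      _ ≤ F (w k) := ENNReal.le_tsum i
  · refine absurd hlt (not_lt.2 ?_)
    refine le_trans ?_ (ENNReal.le_tsum i)
    exact ENNReal.zpow_le_of_le (by exact_mod_cast Nat.one_le_iff_ne_zero.2 hq) (by omega)

theorem boundaryMeasure_shadow (hG : G.IsTree) [G.LocallyFinite] {q : ℕ} (hq : q ≠ 0)
    (hreg : G.IsRegularOfDegree (q + 1)) {O v : V} (hv : v ≠ O) :
    boundaryMeasure hG hq hreg O (shadow G O v) = (q : ℝ≥0∞) ^ (1 - (G.dist O v : ℤ)) := by
  have hm : MeasurableSet (shadow G O v) :=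
    (TopologicalSpace.isOpen_generateFrom_of_mem ⟨v, rfl⟩ : IsOpen (shadow G O v)).measurableSet
  rw [boundaryMeasure, toMeasure_apply _ _ hm]
  refine le_antisymm (boundaryOuterMeasure_shadow_le q hv) ?_
  rw [boundaryOuterMeasure, OuterMeasure.boundedBy_apply]
  refine le_iInf fun t => le_iInf fun ht => ?_
  refine ENNReal.le_of_forall_pos_le_add fun ε hε htop => ?_
  obtain ⟨δ, hδ, hδε⟩ := ENNReal.exists_pos_sum_of_countable
    (ENNReal.coe_ne_zero.2 hε.ne') {i : ℕ // (t i).Nonempty}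
  have hch : ∀ i : {i : ℕ // (t i).Nonempty}, ∃ w : V, t i = shadow G O w ∧
      (q : ℝ≥0∞) ^ (1 - (G.dist O w : ℤ)) < cylinderWeight G q O (t i) + δ i := by
    intro i
    have hfin : cylinderWeight G q O (t i) < ∞ := by
      refine lt_of_le_of_lt ?_ htop
      refine le_trans ?_ (ENNReal.le_tsum (i : ℕ))
      rw [iSup_pos i.2]
    have h1 := ENNReal.lt_add_right hfin.ne (ENNReal.coe_ne_zero.2 (hδ i).ne')
    nth_rewrite 1 [cylinderWeight] at h1
    simp only [iInf_lt_iff] at h1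
    obtain ⟨w, -, h2, h3⟩ := h1
    exact ⟨w, h2, h3⟩
  choose u hu hu' using hch
  calc (q : ℝ≥0∞) ^ (1 - (G.dist O v : ℤ))
      ≤ ∑' i, (q : ℝ≥0∞) ^ (1 - (G.dist O (u i) : ℤ)) := by
        refine weight_le_tsum hG hq hreg hv u fun ω hω => ?_
        obtain ⟨i, hi⟩ := Set.mem_iUnion.1 (ht hω)
        refine Set.mem_iUnion.2 ⟨⟨i, ⟨ω, hi⟩⟩, ?_⟩
        rw [← hu]
        exact hi
    _ ≤ ∑' i : {i : ℕ // (t i).Nonempty}, (cylinderWeight G q O (t i) + δ i) :=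
        ENNReal.tsum_le_tsum fun i => (hu' i).le
    _ = ∑' i : {i : ℕ // (t i).Nonempty}, cylinderWeight G q O (t i) + ∑' i, (δ i : ℝ≥0∞) :=
        ENNReal.tsum_add
    _ ≤ _ := by
        refine add_le_add ?_ hδε.le
        have h1 : ∀ i : {i : ℕ // (t i).Nonempty}, cylinderWeight G q O (t i)
            = ⨆ _ : (t i).Nonempty, cylinderWeight G q O (t i) := fun i => by rw [iSup_pos i.2]
        rw [tsum_congr h1]
        exact ENNReal.tsum_comp_le_tsum_of_injective Subtype.val_injective
          (fun i : ℕ => ⨆ _ : (t i).Nonempty, cylinderWeight G q O (t i))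

end Measure

/-! ### Automorphisms of a measure space and full groups -/

section FullGroup

variable {Ω : Type u} [MeasurableSpace Ω]

/-- `Aut(Ω, μ)`: the group of bimeasurable bijections of `Ω` that preserve the measure class
of `μ`. -/
def measureAut (μ : Measure Ω) : Subgroup (Equiv.Perm Ω) where
  carrier := {T | Measure.QuasiMeasurePreserving T μ μ ∧
    Measure.QuasiMeasurePreserving T.symm μ μ}
  one_mem' := ⟨Measure.QuasiMeasurePreserving.id μ, Measure.QuasiMeasurePreserving.id μ⟩
  mul_mem' := fun hS hT => ⟨hS.1.comp hT.1, hT.2.comp hS.2⟩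
  inv_mem' := fun hT => ⟨hT.2, hT.1⟩

/-- The full group `[Γ]` of a group `Γ` acting on `(Ω, μ)`. -/
def fullGroup (Γ : Type*) [Group Γ] [MulAction Γ Ω] (μ : Measure Ω) :
    Subgroup (Equiv.Perm Ω) where
  carrier := {T | T ∈ measureAut μ ∧ ∀ᵐ ω ∂μ, T ω ∈ MulAction.orbit Γ ω}
  one_mem' := ⟨one_mem _, Filter.Eventually.of_forall fun ω => MulAction.mem_orbit_self ω⟩
  mul_mem' := by
    rintro S T ⟨hS, hS'⟩ ⟨hT, hT'⟩
    refine ⟨mul_mem hS hT, ?_⟩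
    filter_upwards [hT', hT.1.ae hS'] with ω h1 h2
    rw [← MulAction.orbit_eq_iff.2 h1]
    exact h2
  inv_mem' := by
    rintro T ⟨hT, hT'⟩
    refine ⟨inv_mem hT, ?_⟩
    filter_upwards [hT.2.ae hT'] with ω h
    rw [Equiv.apply_symm_apply] at h
    exact MulAction.mem_orbit_symm.1 h

end FullGroup

/-! ### Lattices -/

section Lattice

variable {V : Type u} (G : SimpleGraph V)

/-- The compact open topology on the automorphism group of a graph, that is, the topology of
pointwise convergence on the discrete set of vertices. -/
abbrev autTopology : TopologicalSpace (G ≃g G) :=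
  TopologicalSpace.induced (fun g v => g v) (@Pi.topologicalSpace V (fun _ => V) fun _ => ⊥)

/-- `Γ` is a free uniform lattice in the automorphism group of the locally finite tree `G`: it is
discrete, no nontrivial element stabilizes a vertex or a geometric edge, and the quotient graph
is finite (it has finitely many vertices, hence finitely many edges). -/
structure IsFreeUniformLattice (Γ : Subgroup (G ≃g G)) : Prop where
  discrete : @DiscreteTopology Γ (TopologicalSpace.induced Subtype.val (autTopology G))
  free_vertex : ∀ g ∈ Γ, g ≠ 1 → ∀ v : V, g v ≠ v
  free_edge : ∀ g ∈ Γ, g ≠ 1 → ∀ e ∈ G.edgeSet, Sym2.map g e ≠ e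
  cocompact : Finite (MulAction.orbitRel.Quotient Γ V)

end Lattice

end TreeBoundary

/-! Take for `H` the group of all measure preserving elements of the full group. It is large because
of swaps: if `g ∈ Γ` carries an edge pointing away from `O` to another such edge at the same
distance from `O`, then exchanging the shadows of their end points by `g` and `g⁻¹` preserves the
measure (`measurePreserving_swapMap`). Hence an invariant set `s` occupies equal parts of the two
shadows (`measure_inter_shadow_eq`).

Suppose neither `s` nor its complement is null. By approximation, every large sphere contains `v`
with `Ω_v` almost inside `s` and `w` with `Ω_w` almost outside (`exists_measure_diff_lt`). If some
`k` levels further down `v` and `w` have descendants whose incoming edges lie in one `Γ`-orbit, a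
swap gives a contradiction, provided that `k` is bounded independently of the sphere.

Such descendants come from the finite set of `Γ`-orbits of oriented edges with the relation of
non-backtracking continuation. By freeness each orbit has `q` successors and `q` predecessors, so
reachability is symmetric (`StepsTo.exists_return`). As `O` has at least three neighbours, some edge
into `O` continues along both geodesics `[O, v]` and `[O, w]`. Returning to it from both ends and
composing the loops in different orders gives continuations of equal length and type
(`exists_common_stepsTo`); no aperiodicity is needed. Finiteness of the set of types bounds the
length. -/

namespace TreeBoundary

universe u

/-! ### Geodesics from `O`, shadows, and generators of the Borel sets -/

section Rays

variable {V : Type u} {G : SimpleGraph V}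

/-- A semi-geodesic that moves away from `O` at one step does so forever. -/
lemma Ray.dist_add_of_dist_succ (hG : G.IsTree) (x : Ray G) {O : V} {m : ℕ}
    (h : G.dist O (x.vertex (m + 1)) = G.dist O (x.vertex m) + 1) (k : ℕ) :
    G.dist O (x.vertex (m + k)) = G.dist O (x.vertex m) + k := by
  have key : ∀ k, G.dist O (x.vertex (m + k + 1)) = G.dist O (x.vertex (m + k)) + 1 := by
    intro k
    induction k with
    | zero => exact h
    | succ k ih =>
      rcases hG.dist_eq_dist_add_one_of_adj O (x.adj (m + k + 1)) with h1 | h1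
      -- A step back towards `O` would lead to the unique parent, i.e. to the vertex two steps
      -- earlier on the ray.
      · have h2 := parent_unique hG (x.adj (m + k)) (x.adj (m + k + 1)).symm ih h1
        have h3 := x.dist_eq (m + k) 2
        rw [h2, show m + k + 2 = m + k + 1 + 1 from rfl] at h3
        simp at h3
      · exact h1
  induction k with
  | zero => rfl
  | succ k ih => rw [← add_assoc, key, ih, add_assoc]

/-- The part of a semi-geodesic that moves away from `O` is part of a semi-geodesic
starting at `O`. -/
lemma Ray.exists_base_of_dist_succ (hG : G.IsTree) (x : Ray G) {O : V} {m : ℕ}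
    (h : G.dist O (x.vertex (m + 1)) = G.dist O (x.vertex m) + 1) :
    ∃ y : Ray G, Boundary.mk O y = Boundary.mk O x ∧ y.vertex 0 = O ∧
      ∀ k, y.vertex (G.dist O (x.vertex m) + k) = x.vertex (m + k) := by
  obtain ⟨y, hy, hyx⟩ := exists_ray_extending hG (O := O) (v := x.vertex m)
    (fun k => x.vertex (m + k)) rfl (fun k => x.adj (m + k)) (x.dist_add_of_dist_succ hG h)
  exact ⟨y, Quotient.sound ⟨_, m, hyx⟩, hy, hyx⟩

/-- Every boundary point is represented by a semi-geodesic starting at `O`. -/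
lemma exists_base_ray (hG : G.IsTree) {O : V} (ω : Boundary G O) :
    ∃ x : Ray G, Boundary.mk O x = ω ∧ x.vertex 0 = O := by
  obtain ⟨x, rfl⟩ : ∃ x : Ray G, Boundary.mk O x = ω := Quotient.exists_rep ω
  obtain ⟨m, hm⟩ : ∃ m, G.dist O (x.vertex (m + 1)) = G.dist O (x.vertex m) + 1 := by
    -- Otherwise every step would bring the ray closer to `O`, which is impossible after `G.dist O
    -- (x.vertex 0)` steps.
    by_contra! hcon
    have key : ∀ m, G.dist O (x.vertex m) + m = G.dist O (x.vertex 0) := by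
      intro m
      induction m with
      | zero => rfl
      | succ m ih =>
        have := (hG.dist_eq_dist_add_one_of_adj O (x.adj m)).resolve_right (hcon m)
        omega
    have := key (G.dist O (x.vertex 0) + 1)
    omega
  obtain ⟨y, hy, hy0, -⟩ := x.exists_base_of_dist_succ hG hm
  exact ⟨y, hy, hy0⟩

lemma exists_mem_shadow_dist (hG : G.IsTree) {O : V} (ω : Boundary G O) (n : ℕ) :
    ∃ v, G.dist O v = n ∧ ω ∈ shadow G O v := by
  obtain ⟨x, rfl, hx⟩ := exists_base_ray hG ω
  exact ⟨x.vertex n, x.dist_base hx n, x, rfl, hx, n, rfl⟩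

lemma eq_of_mem_shadow (hG : G.IsTree) {O v w : V} {ω : Boundary G O}
    (hd : G.dist O v = G.dist O w) (hv : ω ∈ shadow G O v) (hw : ω ∈ shadow G O w) : v = w := by
  obtain ⟨x, rfl, hx⟩ := exists_base_ray hG ω
  rw [Ray.mem_shadow hG hx] at hv hw
  rw [← hv, ← hw, hd]

lemma disjoint_shadow (hG : G.IsTree) {O v w : V} (hd : G.dist O v = G.dist O w) (hne : v ≠ w) :
    Disjoint (shadow G O v) (shadow G O w) :=
  Set.disjoint_left.2 fun _ hv hw => hne (eq_of_mem_shadow hG hd hv hw)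

lemma shadow_subset_or_disjoint (hG : G.IsTree) {O v w : V} (hd : G.dist O w ≤ G.dist O v) :
    shadow G O v ⊆ shadow G O w ∨ Disjoint (shadow G O v) (shadow G O w) := by
  by_cases h : Disjoint (shadow G O v) (shadow G O w)
  · exact Or.inr h
  · obtain ⟨ω, h1, h2⟩ := Set.not_disjoint_iff.1 h
    exact Or.inl (shadow_subset_of_mem hG hd h1 h2)

lemma measurableSet_shadow (O v : V) : MeasurableSet (shadow G O v) :=
  (TopologicalSpace.isOpen_generateFrom_of_mem ⟨v, rfl⟩ : IsOpen (shadow G O v)).measurableSet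

lemma exists_parent (hG : G.IsTree) {O v : V} {n : ℕ} (h : G.dist O v = n + 1) :
    ∃ u, G.Adj u v ∧ G.dist O u = n := by
  obtain ⟨p, hp⟩ := hG.connected.exists_walk_length_eq_dist v O
  cases p with
  | nil => simp at h
  | @cons _ u _ hadj p =>
    refine ⟨u, hadj.symm, ?_⟩
    rw [G.dist_comm, SimpleGraph.Walk.length_cons] at hp
    have h1 := SimpleGraph.dist_le p
    rw [G.dist_comm] at h1
    rcases hG.dist_eq_dist_add_one_of_adj O hadj with h2 | h2 <;> omega

lemma finite_sphere (hG : G.IsTree) [G.LocallyFinite] (O : V) (n : ℕ) :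
    {v | G.dist O v = n}.Finite := by
  induction n with
  | zero =>
    refine (Set.finite_singleton O).subset fun v hv => ?_
    exact ((hG.connected.dist_eq_zero_iff).1 hv).symm
  | succ n ih =>
    refine (ih.biUnion fun u _ => (G.neighborSet u).toFinite).subset fun v hv => ?_
    obtain ⟨u, hu, hdu⟩ := exists_parent hG hv
    exact Set.mem_biUnion (x := u) hdu hu

lemma shadow_eq_biUnion_children (hG : G.IsTree) [G.LocallyFinite] (O v : V) :
    shadow G O v = ⋃ c ∈ children (G := G) O v, shadow G O c :=
  (shadow_subset_children hG O v).antisymm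
    (Set.iUnion₂_subset fun _ hc => shadow_child_subset hG hc)

lemma shadow_base (hG : G.IsTree) (O : V) : shadow G O O = Set.univ := by
  refine Set.eq_univ_of_forall fun ω => ?_
  obtain ⟨x, rfl, hx⟩ := exists_base_ray hG ω
  exact ⟨x, rfl, hx, 0, hx⟩

/-- The Borel sets of the boundary are generated by the sets `Ω_v` with `v` far from `O`. -/
lemma borel_eq_generateFrom_shadow (hG : G.IsTree) [G.LocallyFinite] (O : V) (N : ℕ) :
    (inferInstance : MeasurableSpace (Boundary G O))
      = MeasurableSpace.generateFrom {s | ∃ v, N ≤ G.dist O v ∧ s = shadow G O v} := by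
  have hc : Countable V := countable_of_locallyFinite hG.connected O
  have hsc : SecondCountableTopology (Boundary G O) := ⟨_, Set.countable_range (shadow G O), rfl⟩
  have hb : (inferInstance : MeasurableSpace (Boundary G O))
      = MeasurableSpace.generateFrom (Set.range (shadow G O)) :=
    borel_eq_generateFrom_of_subbasis rfl
  refine le_antisymm ?_ (MeasurableSpace.generateFrom_le ?_)
  · rw [hb]
    refine MeasurableSpace.generateFrom_le ?_
    rintro _ ⟨v, rfl⟩
    -- Here `k` bounds the number of levels by which `v` falls short of radius `N`; each level is
    -- gained by splitting into the finitely many children.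
    have key : ∀ (k : ℕ) (v : V), N ≤ G.dist O v + k →
        MeasurableSet[MeasurableSpace.generateFrom
          {s | ∃ v, N ≤ G.dist O v ∧ s = shadow G O v}] (shadow G O v) := by
      intro k
      induction k with
      | zero => exact fun v hv => MeasurableSpace.measurableSet_generateFrom ⟨v, hv, rfl⟩
      | succ k ih =>
        intro v hv
        rw [shadow_eq_biUnion_children hG]
        refine Finset.measurableSet_biUnion _ fun c hc => ih c ?_
        rw [(mem_children.1 hc).2]
        omega
    exact key N v (by omega)
  · rintro _ ⟨v, -, rfl⟩
    exact measurableSet_shadow O v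

/-- Shadows that meet are nested, so the intersection is the one with the farther vertex. -/
lemma isPiSystem_shadow (hG : G.IsTree) (O : V) (N : ℕ) :
    IsPiSystem {s | ∃ v, N ≤ G.dist O v ∧ s = shadow G O v} := by
  rintro _ ⟨v, hv, rfl⟩ _ ⟨w, hw, rfl⟩ ⟨ω, h1, h2⟩
  rcases le_total (G.dist O v) (G.dist O w) with h | h
  · exact ⟨w, hw, Set.inter_eq_right.2 (shadow_subset_of_mem hG h h2 h1)⟩
  · exact ⟨v, hv, Set.inter_eq_left.2 (shadow_subset_of_mem hG h h1 h2)⟩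

/-- The sets which are unions of sets `Ω_v` for `v` in some sphere. -/
def levelSets (G : SimpleGraph V) (O : V) : Set (Set (Boundary G O)) :=
  {s | ∃ n, ∀ m, n ≤ m → ∀ v, G.dist O v = m →
    shadow G O v ⊆ s ∨ Disjoint (shadow G O v) s}

/-- The dichotomy holds in all spheres from some radius on, so two sets can be compared beyond the
larger of their radii. -/
lemma isSetAlgebra_levelSets (O : V) : IsSetAlgebra (levelSets G O) where
  empty_mem := ⟨0, fun _ _ _ _ => Or.inr (Set.disjoint_empty _)⟩
  compl_mem := by
    rintro s ⟨n, hn⟩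
    refine ⟨n, fun m hm v hv => ?_⟩
    rw [Set.disjoint_compl_right_iff_subset, Set.subset_compl_iff_disjoint_right]
    exact (hn m hm v hv).symm
  union_mem := by
    rintro s t ⟨n, hn⟩ ⟨n', hn'⟩
    refine ⟨max n n', fun m hm v hv => ?_⟩
    rw [Set.disjoint_union_right]
    rcases hn m (le_of_max_le_left hm) v hv with h | h
    · exact Or.inl (h.trans Set.subset_union_left)
    · rcases hn' m (le_of_max_le_right hm) v hv with h' | h'
      · exact Or.inl (h'.trans Set.subset_union_right)
      · exact Or.inr ⟨h, h'⟩

lemma shadow_mem_levelSets (hG : G.IsTree) (O v : V) : shadow G O v ∈ levelSets G O :=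
  ⟨G.dist O v, fun _ hm _ hw => shadow_subset_or_disjoint hG (hw ▸ hm)⟩

end Rays

/-! ### Measure preserving maps and approximation by shadows -/

section Measure

variable {V : Type u} {G : SimpleGraph V} [G.LocallyFinite] {q : ℕ}

lemma isFiniteMeasure_boundaryMeasure (hG : G.IsTree) (hq : q ≠ 0)
    (hreg : G.IsRegularOfDegree (q + 1)) (O : V) :
    IsFiniteMeasure (boundaryMeasure hG hq hreg O) := by
  refine ⟨?_⟩
  rw [← shadow_base hG O, shadow_eq_biUnion_children hG]
  refine (measure_biUnion_finset_le _ _).trans_lt (ENNReal.sum_lt_top.2 fun c hc => ?_)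
  rw [boundaryMeasure_shadow hG hq hreg (children_ne hc)]
  exact ENNReal.zpow_lt_top (by exact_mod_cast hq) (ENNReal.natCast_ne_top q) _

lemma boundaryMeasure_shadow_ne_zero (hG : G.IsTree) (hq : q ≠ 0)
    (hreg : G.IsRegularOfDegree (q + 1)) {O v : V} (hv : v ≠ O) :
    boundaryMeasure hG hq hreg O (shadow G O v) ≠ 0 := by
  rw [boundaryMeasure_shadow hG hq hreg hv]
  exact (ENNReal.zpow_pos (by exact_mod_cast hq) (ENNReal.natCast_ne_top q) _).ne'

lemma shadow_nonempty (hG : G.IsTree) (hq : q ≠ 0)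
    (hreg : G.IsRegularOfDegree (q + 1)) {O v : V} (hv : v ≠ O) : (shadow G O v).Nonempty :=
  nonempty_of_measure_ne_zero (boundaryMeasure_shadow_ne_zero hG hq hreg hv)

/-- A transformation whose inverse permutes the sets `Ω_v`, for `v` far from `O`, respecting the
distance to `O`, preserves the measure. -/
lemma measurePreserving_of_preimage_shadow (hG : G.IsTree) (hq : q ≠ 0)
    (hreg : G.IsRegularOfDegree (q + 1)) {O : V} {T : Boundary G O → Boundary G O} {N : ℕ}
    (hN : N ≠ 0)
    (hT : ∀ v, N ≤ G.dist O v →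
      ∃ w, G.dist O w = G.dist O v ∧ T ⁻¹' shadow G O v = shadow G O w) :
    MeasurePreserving T (boundaryMeasure hG hq hreg O) (boundaryMeasure hG hq hreg O) := by
  have := isFiniteMeasure_boundaryMeasure hG hq hreg O
  have hgen := borel_eq_generateFrom_shadow hG O N
  have hm : Measurable T := by
    refine @measurable_generateFrom _ _ _ {s | ∃ v, N ≤ G.dist O v ∧ s = shadow G O v} T ?_
      |>.mono le_rfl hgen.le
    rintro _ ⟨v, hv, rfl⟩
    obtain ⟨w, -, hw⟩ := hT v hv
    rw [hw]
    exact measurableSet_shadow O w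
  refine ⟨hm, ext_of_generate_finite _ hgen (isPiSystem_shadow hG O N) ?_ ?_⟩
  · rintro _ ⟨v, hv, rfl⟩
    obtain ⟨w, hd, hw⟩ := hT v hv
    -- The root must be avoided: the total mass is `q + 1`, not the value `q` that the formula would
    -- give at `O`.
    have hv0 : v ≠ O := by
      rintro rfl
      simp at hv
      exact hN hv
    have hw0 : w ≠ O := by
      rintro rfl
      simp at hd
      omega
    rw [Measure.map_apply hm (measurableSet_shadow O v), hw, boundaryMeasure_shadow hG hq hreg hv0,
      boundaryMeasure_shadow hG hq hreg hw0, hd]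
  · rw [Measure.map_apply hm MeasurableSet.univ, Set.preimage_univ]

lemma measurableSet_of_mem_levelSets (hG : G.IsTree) {O : V} {s : Set (Boundary G O)}
    (hs : s ∈ levelSets G O) : MeasurableSet s := by
  obtain ⟨n, hn⟩ := hs
  have : s = ⋃ v ∈ {v | G.dist O v = n ∧ shadow G O v ⊆ s}, shadow G O v := by
    refine Set.Subset.antisymm (fun ω hω => ?_) (Set.iUnion₂_subset fun v hv => hv.2)
    obtain ⟨v, hv, hωv⟩ := exists_mem_shadow_dist hG ω n
    refine Set.mem_biUnion (x := v) ⟨hv, (hn n le_rfl v hv).resolve_right fun h => ?_⟩ hωv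
    exact Set.disjoint_left.1 h hωv hω
  rw [this]
  exact ((finite_sphere hG O n).subset fun v hv => hv.1).measurableSet_biUnion
    fun v _ => measurableSet_shadow O v

lemma borel_eq_generateFrom_levelSets (hG : G.IsTree) (O : V) :
    (inferInstance : MeasurableSpace (Boundary G O))
      = MeasurableSpace.generateFrom (levelSets G O) := by
  refine le_antisymm ?_
    (MeasurableSpace.generateFrom_le fun s hs => measurableSet_of_mem_levelSets hG hs)
  rw [borel_eq_generateFrom_shadow hG O 0]
  refine MeasurableSpace.generateFrom_mono ?_
  rintro _ ⟨v, -, rfl⟩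
  exact shadow_mem_levelSets hG O v

/-- A set of positive measure fills some sets `Ω_v`, with `v` in any sphere of large radius, up to
a small proportion. -/
lemma exists_measure_diff_lt (hG : G.IsTree) (hq : q ≠ 0) (hreg : G.IsRegularOfDegree (q + 1))
    {O : V} {s : Set (Boundary G O)} (hs : MeasurableSet s)
    (h0 : boundaryMeasure hG hq hreg O s ≠ 0) {ε : ℝ} (hε : 0 < ε) :
    ∃ n, ∀ m, n ≤ m → ∃ v, G.dist O v = m ∧
      (boundaryMeasure hG hq hreg O).real (shadow G O v \ s)
        < ε * (boundaryMeasure hG hq hreg O).real (shadow G O v) := by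
  have := isFiniteMeasure_boundaryMeasure hG hq hreg O
  set μ := boundaryMeasure hG hq hreg O
  have hpos : 0 < μ.real s := ENNReal.toReal_pos h0 (measure_ne_top _ _)
  -- Chosen so that `ε * μ t ≤ μ (t \ s) < δ` and `μ s < μ t + δ` contradict each other.
  set δ := ε * μ.real s / (1 + ε) with hδ
  obtain ⟨t, ⟨n, hn⟩, ht⟩ := (Measure.MeasureDense.of_generateFrom_isSetAlgebra_finite μ
    (isSetAlgebra_levelSets O) (borel_eq_generateFrom_levelSets hG O)).approx s hs
    (measure_ne_top _ _) δ (by positivity)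
  have htm := measurableSet_of_mem_levelSets hG ⟨n, hn⟩
  refine ⟨n, fun m hm => ?_⟩
  by_contra! hcon
  have hfin := (finite_sphere hG O m).subset
    (fun v (hv : v ∈ {v | G.dist O v = m ∧ shadow G O v ⊆ t}) => hv.1)
  set F := hfin.toFinset with hF
  have hFm : ∀ v, v ∈ F ↔ G.dist O v = m ∧ shadow G O v ⊆ t := fun v => by simp [hF]
  have htF : t = ⋃ v ∈ F, shadow G O v := by
    refine Set.Subset.antisymm (fun ω hω => ?_)
      (Set.iUnion₂_subset fun v hv => ((hFm v).1 hv).2)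
    obtain ⟨v, hv, hωv⟩ := exists_mem_shadow_dist hG ω m
    refine Set.mem_biUnion (x := v)
      ((hFm v).2 ⟨hv, (hn m hm v hv).resolve_right fun h => ?_⟩) hωv
    exact Set.disjoint_left.1 h hωv hω
  have hdisj : Set.PairwiseDisjoint (F : Set V) (shadow G O) := fun v hv w hw hne =>
    disjoint_shadow hG (((hFm v).1 hv).1.trans ((hFm w).1 hw).1.symm) hne
  -- The set `t` is a disjoint union of shadows from the sphere of radius `m`, each assumed to miss
  -- `s` in proportion at least `ε`.
  have h1 : ε * μ.real t ≤ μ.real (t \ s) := by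
    rw [htF]
    simp only [Set.iUnion_sdiff]
    rw [measureReal_biUnion_finset hdisj fun v _ => measurableSet_shadow O v,
      measureReal_biUnion_finset
      (fun v hv w hw hne => (hdisj hv hw hne).mono Set.sdiff_subset Set.sdiff_subset)
      fun v _ => (measurableSet_shadow O v).diff hs, Finset.mul_sum]
    exact Finset.sum_le_sum fun v hv => hcon v ((hFm v).1 hv).1
  have hsd : μ.real (symmDiff s t) < δ := by
    rw [measureReal_def]
    exact ENNReal.toReal_lt_of_lt_ofReal ht
  have h2 : μ.real (t \ s) ≤ μ.real (symmDiff s t) :=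
    measureReal_mono Set.subset_union_right
  have h3 : μ.real s ≤ μ.real t + μ.real (symmDiff s t) := by
    refine (measureReal_mono (s₂ := t ∪ symmDiff s t) fun ω hω => ?_).trans
      (measureReal_union_le _ _)
    by_cases h : ω ∈ t
    · exact Or.inl h
    · exact Or.inr (Or.inl ⟨hω, h⟩)
  have h4 : δ * (1 + ε) = ε * μ.real s := by rw [hδ]; field_simp
  nlinarith

end Measure

/-! ### Swaps of two shadows by an element of `Γ` -/

section Swap

variable {V : Type u} {G : SimpleGraph V}

/-- `g` carries the edge leading to `v` from the side of `O` to the edge leading to `w` from the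
side of `O`, and `v`, `w` are at the same distance from `O`. -/
structure Matches (O : V) (g : G ≃g G) (v w : V) : Prop where
  dist_eq : G.dist O w = G.dist O v
  map_eq : g v = w
  exists_parent : ∃ u, G.Adj u v ∧ G.dist O v = G.dist O u + 1 ∧ G.dist O w = G.dist O (g u) + 1

lemma Matches.symm {O : V} {g : G ≃g G} {v w : V} (h : Matches O g v w) : Matches O g⁻¹ w v := by
  obtain ⟨u, hu, hv, hw⟩ := h.exists_parent
  refine ⟨h.dist_eq.symm, ?_, g u, ?_, hw, ?_⟩
  · rw [← h.map_eq]
    exact g.symm_apply_apply v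
  · rw [← h.map_eq]
    exact g.map_rel_iff.2 hu
  · rw [hv]
    congr 2
    exact (g.symm_apply_apply u).symm

/-- The image of the semi-geodesic `[O, ω)` with `ω ∈ Ω_v` continues the geodesic `[O, w]`. -/
lemma Matches.exists_ray (hG : G.IsTree) {O : V} {g : G ≃g G} {v w : V} (h : Matches O g v w)
    {x : Ray G} (hx : x.vertex 0 = O) (hxv : x.vertex (G.dist O v) = v) :
    ∃ y : Ray G, Boundary.mk O y = g • Boundary.mk O x ∧ y.vertex 0 = O ∧
      ∀ k, G.dist O v ≤ k → y.vertex k = g (x.vertex k) := by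
  obtain ⟨u, hu, hv, hw⟩ := h.exists_parent
  have hxu : x.vertex (G.dist O u) = u := by
    have h1 := x.adj (G.dist O u)
    rw [← hv, hxv] at h1
    exact parent_unique hG (O := O) h1 hu (by rw [x.dist_base hx, hv]) hv
  have hd := h.dist_eq
  obtain ⟨y, hy, hy0, hyx⟩ := (x.map g).exists_base_of_dist_succ hG (O := O) (m := G.dist O u) (by
    change G.dist O (g (x.vertex _)) = G.dist O (g (x.vertex _)) + 1
    rw [← hv, hxv, hxu, h.map_eq, hw])
  refine ⟨y, hy, hy0, fun k hk => ?_⟩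
  -- Since `v` and `w` are equally far from `O`, the image ray needs no shift of index.
  have hgu : G.dist O (g u) = G.dist O u := by omega
  have h1 := hyx (k - G.dist O u)
  change y.vertex (G.dist O (g (x.vertex _)) + _) = g (x.vertex _) at h1
  rwa [hxu, hgu, Nat.add_sub_cancel' (by omega)] at h1

/-- From `v` on, the geodesic `[O, g • ω)` is the image of `[O, ω)` vertex by vertex with the same
indices, so `g` keeps the radii of the shadows inside `Ω_v`. -/
lemma Matches.smul_mem (hG : G.IsTree) {O : V} {g : G ≃g G} {v w : V} (h : Matches O g v w)
    {ω : Boundary G O} (hω : ω ∈ shadow G O v) {u : V} (hu : G.dist O v ≤ G.dist O u)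
    (hωu : ω ∈ shadow G O u) : G.dist O (g u) = G.dist O u ∧ g • ω ∈ shadow G O (g u) := by
  obtain ⟨x, rfl, hx⟩ := exists_base_ray hG ω
  rw [Ray.mem_shadow hG hx] at hω hωu
  obtain ⟨y, hyx, hy, hk⟩ := h.exists_ray hG hx hω
  have h1 := hk _ hu
  rw [hωu] at h1
  have h2 : G.dist O (g u) = G.dist O u := by rw [← h1, y.dist_base hy]
  refine ⟨h2, ?_⟩
  rw [← hyx, Ray.mem_shadow hG hy, h2, h1]

lemma Matches.smul_mem_shadow (hG : G.IsTree) {O : V} {g : G ≃g G} {v w : V}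
    (h : Matches O g v w) {ω : Boundary G O} (hω : ω ∈ shadow G O v) : g • ω ∈ shadow G O w :=
  h.map_eq ▸ (h.smul_mem hG hω le_rfl hω).2

open Classical in
/-- The involution exchanging `Ω_v` and `Ω_w` by means of `g`. -/
noncomputable def swapMap (O : V) (g : G ≃g G) (v w : V) (ω : Boundary G O) : Boundary G O :=
  if ω ∈ shadow G O v then g • ω else if ω ∈ shadow G O w then g⁻¹ • ω else ω

section

variable {O : V} {g : G ≃g G} {v w : V}

lemma swapMap_of_mem_left {ω : Boundary G O} (hω : ω ∈ shadow G O v) :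
    swapMap O g v w ω = g • ω := if_pos hω

lemma swapMap_of_mem_right (hG : G.IsTree) (h : Matches O g v w) (hne : v ≠ w)
    {ω : Boundary G O} (hω : ω ∈ shadow G O w) : swapMap O g v w ω = g⁻¹ • ω := by
  have hv : ω ∉ shadow G O v := fun hv => hne (eq_of_mem_shadow hG h.dist_eq.symm hv hω)
  rw [swapMap, if_neg hv, if_pos hω]

lemma swapMap_of_notMem {ω : Boundary G O} (hv : ω ∉ shadow G O v) (hw : ω ∉ shadow G O w) :
    swapMap O g v w ω = ω := by
  rw [swapMap, if_neg hv, if_neg hw]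

lemma swapMap_involutive (hG : G.IsTree) (h : Matches O g v w) (hne : v ≠ w) :
    Function.Involutive (swapMap O g v w) := by
  intro ω
  by_cases hv : ω ∈ shadow G O v
  · rw [swapMap_of_mem_left hv, swapMap_of_mem_right hG h hne (h.smul_mem_shadow hG hv),
      inv_smul_smul]
  · by_cases hw : ω ∈ shadow G O w
    · rw [swapMap_of_mem_right hG h hne hw, swapMap_of_mem_left (h.symm.smul_mem_shadow hG hw),
        smul_inv_smul]
    · rw [swapMap_of_notMem hv hw, swapMap_of_notMem hv hw]

/-- For an involution preimages are images, so the two inclusions are `Matches.smul_mem` for `g` and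
for `g⁻¹`. A point of `Ω_u` supplies the geodesic through `u` that shows `g u` to be as far from `O`
as `u`. -/
lemma swapMap_mem_shadow_left (hG : G.IsTree) (h : Matches O g v w) (hne : v ≠ w)
    {u : V} (hu : G.dist O v ≤ G.dist O u) (huv : shadow G O u ⊆ shadow G O v)
    (hne' : (shadow G O u).Nonempty) :
    G.dist O (g u) = G.dist O u ∧ swapMap O g v w ⁻¹' shadow G O u = shadow G O (g u) := by
  obtain ⟨ω₀, hω₀⟩ := hne'
  have h0 := h.smul_mem hG (huv hω₀) hu hω₀
  have hgu : shadow G O (g u) ⊆ shadow G O w :=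
    shadow_subset_of_mem hG (by rw [h.dist_eq, h0.1]; exact hu) h0.2
      (h.smul_mem_shadow hG (huv hω₀))
  refine ⟨h0.1, Set.Subset.antisymm (fun ω hω => ?_) fun ω hω => ?_⟩
  · rw [← swapMap_involutive hG h hne ω, swapMap_of_mem_left (huv hω)]
    exact (h.smul_mem hG (huv hω) hu hω).2
  · rw [Set.mem_preimage, swapMap_of_mem_right hG h hne (hgu hω)]
    have h1 := (h.symm.smul_mem hG (hgu hω) (u := g u) (by rw [h.dist_eq, h0.1]; exact hu) hω).2
    have h2 : g⁻¹ (g u) = u := g.symm_apply_apply u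
    rwa [h2] at h1

/-- This symmetry reduces shadows inside `Ω_w` to the case of shadows inside `Ω_v`. -/
lemma swapMap_symm (hG : G.IsTree) (h : Matches O g v w) (hne : v ≠ w) :
    swapMap O g⁻¹ w v = swapMap O g v w := by
  funext ω
  by_cases hv : ω ∈ shadow G O v
  · rw [swapMap_of_mem_left hv, swapMap_of_mem_right hG h.symm hne.symm hv, inv_inv]
  · by_cases hw : ω ∈ shadow G O w
    · rw [swapMap_of_mem_right hG h hne hw, swapMap_of_mem_left hw]
    · rw [swapMap_of_notMem hv hw, swapMap_of_notMem hw hv]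

/-- From the radius of `v` on, a shadow lies in `Ω_v`, lies in `Ω_w`, or meets neither; each time
its preimage is a shadow of the same radius. -/
lemma measurePreserving_swapMap [G.LocallyFinite] {q : ℕ} (hG : G.IsTree) (hq : q ≠ 0)
    (hreg : G.IsRegularOfDegree (q + 1)) (h : Matches O g v w) (hne : v ≠ w) :
    MeasurePreserving (swapMap O g v w) (boundaryMeasure hG hq hreg O)
      (boundaryMeasure hG hq hreg O) := by
  obtain ⟨p, -, hp, -⟩ := h.exists_parent
  refine measurePreserving_of_preimage_shadow hG hq hreg (N := G.dist O v) (by omega)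
    fun u hu => ?_
  have hu0 : u ≠ O := by
    rintro rfl
    rw [SimpleGraph.dist_self] at hu
    omega
  have hnon := shadow_nonempty hG hq hreg hu0
  rcases shadow_subset_or_disjoint hG hu with hv | hv
  · exact ⟨_, swapMap_mem_shadow_left hG h hne hu hv hnon⟩
  have huw : G.dist O w ≤ G.dist O u := by rwa [h.dist_eq]
  rcases shadow_subset_or_disjoint hG huw with hw | hw
  · rw [← swapMap_symm hG h hne]
    exact ⟨_, swapMap_mem_shadow_left hG h.symm hne.symm huw hw hnon⟩
  · refine ⟨u, rfl, ?_⟩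
    have hfix : ∀ ω ∈ shadow G O u, swapMap O g v w ω = ω := fun ω hω =>
      swapMap_of_notMem (Set.disjoint_left.1 hv hω) (Set.disjoint_left.1 hw hω)
    refine Set.Subset.antisymm (fun ω hω => ?_) fun ω hω => ?_
    · rw [← swapMap_involutive hG h hne ω, hfix _ hω]
      exact hω
    · rw [Set.mem_preimage, hfix _ hω]
      exact hω

end

/-- The measure preserving elements of the full group. -/
def measurePreservingFullGroup {Ω : Type u} [MeasurableSpace Ω] (Γ : Type*) [Group Γ]
    [MulAction Γ Ω] (μ : Measure Ω) : Subgroup (Equiv.Perm Ω) where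
  carrier := {T | T ∈ fullGroup Γ μ ∧ MeasurePreserving T μ μ ∧ MeasurePreserving T.symm μ μ}
  one_mem' := ⟨one_mem _, .id μ, .id μ⟩
  mul_mem' := fun hS hT => ⟨mul_mem hS.1 hT.1, hS.2.1.comp hT.2.1, hT.2.2.comp hS.2.2⟩
  inv_mem' := fun hT => ⟨inv_mem hT.1, hT.2.2, hT.2.1⟩

lemma swap_mem_measurePreservingFullGroup [G.LocallyFinite] {q : ℕ} (hG : G.IsTree) (hq : q ≠ 0)
    (hreg : G.IsRegularOfDegree (q + 1)) {O v w : V} {Γ : Subgroup (G ≃g G)} {g : G ≃g G}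
    (hg : g ∈ Γ) (h : Matches O g v w) (hne : v ≠ w) :
    (swapMap_involutive hG h hne).toPerm ∈
      measurePreservingFullGroup Γ (boundaryMeasure hG hq hreg O) := by
  have hmp := measurePreserving_swapMap hG hq hreg h hne
  refine ⟨⟨⟨hmp.quasiMeasurePreserving, hmp.quasiMeasurePreserving⟩, ?_⟩, hmp, hmp⟩
  refine Filter.Eventually.of_forall fun ω => ?_
  change swapMap O g v w ω ∈ _
  by_cases hv : ω ∈ shadow G O v
  · rw [swapMap_of_mem_left hv]
    exact ⟨⟨g, hg⟩, rfl⟩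
  · by_cases hw : ω ∈ shadow G O w
    · rw [swapMap_of_mem_right hG h hne hw]
      exact ⟨⟨g⁻¹, inv_mem hg⟩, rfl⟩
    · rw [swapMap_of_notMem hv hw]
      exact MulAction.mem_orbit_self ω

/-- A set invariant under the measure preserving part of the full group fills `Ω_v` and `Ω_w` to
the same extent if an element of `Γ` carries one to the other preserving distances to `O`. -/
lemma measure_inter_shadow_eq [G.LocallyFinite] {q : ℕ} (hG : G.IsTree) (hq : q ≠ 0)
    (hreg : G.IsRegularOfDegree (q + 1)) {O v w : V} {Γ : Subgroup (G ≃g G)} {g : G ≃g G}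
    (hg : g ∈ Γ) (h : Matches O g v w) {s : Set (Boundary G O)} (hs : MeasurableSet s)
    (hinv : ∀ T ∈ measurePreservingFullGroup Γ (boundaryMeasure hG hq hreg O),
      T ⁻¹' s =ᵐ[boundaryMeasure hG hq hreg O] s) :
    boundaryMeasure hG hq hreg O (s ∩ shadow G O v)
      = boundaryMeasure hG hq hreg O (s ∩ shadow G O w) := by
  by_cases hne : v = w
  · rw [hne]
  have hmp := measurePreserving_swapMap hG hq hreg h hne
  have hpre : swapMap O g v w ⁻¹' shadow G O w = shadow G O v := by
    refine Set.Subset.antisymm (fun ω hω => ?_) fun ω hω => ?_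
    · rw [← swapMap_involutive hG h hne ω, swapMap_of_mem_right hG h hne hω]
      exact h.symm.smul_mem_shadow hG hω
    · rw [Set.mem_preimage, swapMap_of_mem_left hω]
      exact h.smul_mem_shadow hG hω
  have hT := hinv _ (swap_mem_measurePreservingFullGroup hG hq hreg hg h hne)
  rw [← hmp.measure_preimage (hs.inter (measurableSet_shadow O w)).nullMeasurableSet,
    Set.preimage_inter, hpre]
  exact (measure_congr (hT.inter (ae_eq_refl _))).symm

end Swap

/-! ### Reachability in a finite balanced relation -/

section Steps

variable {T : Type*} (R : T → T → Prop)

/-- `t` is reached from `s` in `n` steps of the relation `R`. -/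
def StepsTo : ℕ → T → T → Prop
  | 0 => Eq
  | n + 1 => fun s t => ∃ r, StepsTo n s r ∧ R r t

variable {R}

lemma StepsTo.trans {m n : ℕ} {r s t : T} (h : StepsTo R m r s) (h' : StepsTo R n s t) :
    StepsTo R (m + n) r t := by
  induction n generalizing t with
  | zero => exact h' ▸ h
  | succ n ih =>
    obtain ⟨u, hu, hut⟩ := h'
    exact ⟨u, ih hu, hut⟩

lemma StepsTo.single {s t : T} (h : R s t) : StepsTo R 1 s t := ⟨s, rfl, h⟩

/-- In a finite set in which all points have as many successors as predecessors, a set closed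
under successors is closed under predecessors. -/
lemma mem_of_closed_of_card_eq {A : Set T} (hA : A.Finite) {q : ℕ}
    (hclosed : ∀ a ∈ A, ∀ b, R a b → b ∈ A)
    (hout : ∀ a ∈ A, {b | R a b}.ncard = q)
    (hfin : ∀ b ∈ A, {a | R a b}.Finite) (hin : ∀ b ∈ A, {a | R a b}.ncard = q)
    {a b : T} (hb : b ∈ A) (hab : R a b) : a ∈ A := by
  classical
  lift A to Finset T using hA
  simp only [Finset.mem_coe] at *
  by_contra ha
  -- Count the related pairs in `A × A` twice: every row has exactly `q` entries because `A` is
  -- closed, every column at most `q`, and the column of `b` fewer if `a ∉ A`.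
  have h1 : ∀ c ∈ A, (A.bipartiteAbove R c).card = q := by
    intro c hc
    rw [← hout c hc, ← Set.ncard_coe_finset]
    congr 1
    ext d
    simp only [Finset.coe_bipartiteAbove, Set.mem_ofPred_eq]
    exact ⟨fun h => h.2, fun h => ⟨hclosed c hc d h, h⟩⟩
  have hsub : ∀ d, ((A.bipartiteBelow R d : Finset T) : Set T) ⊆ {c | R c d} := by
    intro d c hc
    simpa using ((Finset.mem_bipartiteBelow R).1 hc).2
  have h2 : ∀ d ∈ A, (A.bipartiteBelow R d).card ≤ q := by
    intro d hd
    rw [← hin d hd, ← Set.ncard_coe_finset]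
    exact Set.ncard_le_ncard (hsub d) (hfin d hd)
  have h3 : (A.bipartiteBelow R b).card < q := by
    rw [← hin b hb, ← Set.ncard_coe_finset]
    refine Set.ncard_lt_ncard ⟨hsub b, fun h => ha ?_⟩ (hfin b hb)
    exact ((Finset.mem_bipartiteBelow R).1 (h hab)).1
  have h4 := Finset.sum_card_bipartiteAbove_eq_sum_card_bipartiteBelow (s := A) (t := A) R
  have h5 := Finset.sum_lt_sum h2 ⟨b, hb, h3⟩
  rw [← h4, Finset.sum_congr rfl h1] at h5
  exact lt_irrefl _ h5

end Steps

/-! ### Orbits of oriented edges and their non-backtracking continuations -/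

section EdgeTypes

variable {V : Type u} {G : SimpleGraph V} (Γ : Subgroup (G ≃g G))

/-- The orbit of the pair `(a, b)` of vertices. -/
def edgeType (a b : V) : MulAction.orbitRel.Quotient Γ (V × V) := Quotient.mk'' (a, b)

variable {Γ}

lemma edgeType_eq_iff {a b c d : V} :
    edgeType Γ a b = edgeType Γ c d ↔ ∃ g ∈ Γ, g c = a ∧ g d = b := by
  rw [edgeType, edgeType, Quotient.eq'', MulAction.orbitRel_apply, MulAction.mem_orbit_iff]
  constructor
  · rintro ⟨g, hg⟩
    exact ⟨g, g.2, congrArg Prod.fst hg, congrArg Prod.snd hg⟩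
  · rintro ⟨g, hg, h1, h2⟩
    exact ⟨⟨g, hg⟩, Prod.ext h1 h2⟩

variable (Γ)

/-- The types of oriented edges. -/
def edgeTypes : Set (MulAction.orbitRel.Quotient Γ (V × V)) :=
  {t | ∃ a b, G.Adj a b ∧ t = edgeType Γ a b}

/-- An edge of the second type continues an edge of the first type without backtracking. -/
def Follows (s t : MulAction.orbitRel.Quotient Γ (V × V)) : Prop :=
  ∃ a b c, G.Adj a b ∧ G.Adj b c ∧ a ≠ c ∧ s = edgeType Γ a b ∧ t = edgeType Γ b c

/-- The initial vertex can be moved to one of finitely many orbit representatives, each with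
finitely many neighbours. -/
lemma finite_edgeTypes [G.LocallyFinite] (hfin : Finite (MulAction.orbitRel.Quotient Γ V)) :
    (edgeTypes Γ).Finite := by
  refine (Set.finite_iUnion fun o : MulAction.orbitRel.Quotient Γ V =>
    (G.neighborSet o.out).toFinite.image (edgeType Γ o.out)).subset ?_
  rintro _ ⟨a, b, hab, rfl⟩
  refine Set.mem_iUnion.2 ⟨Quotient.mk'' a, ?_⟩
  have h : MulAction.orbitRel Γ V (Quotient.mk'' a : MulAction.orbitRel.Quotient Γ V).out a :=
    Quotient.mk_out (s := MulAction.orbitRel Γ V) a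
  rw [MulAction.orbitRel_apply, MulAction.mem_orbit_iff] at h
  obtain ⟨g, hg⟩ := h
  change (g : G ≃g G) a = _ at hg
  refine ⟨(g : G ≃g G) b, ?_, ?_⟩
  · rw [← hg]
    exact (g : G ≃g G).map_rel_iff.2 hab
  · exact edgeType_eq_iff.2 ⟨g, g.2, hg, rfl⟩

variable {Γ}

/-- A translation by `Γ` moves any representative of the first edge to `(a, b)`, so every successor
type is realised at this very edge. -/
lemma setOf_follows {a b : V} (hab : G.Adj a b) :
    {t | Follows Γ (edgeType Γ a b) t} = edgeType Γ b '' (G.neighborSet b \ {a}) := by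
  ext t
  constructor
  · rintro ⟨a', b', c', -, hbc, hne, hs, rfl⟩
    obtain ⟨g, hg, rfl, rfl⟩ := edgeType_eq_iff.1 hs
    refine ⟨g c', ⟨g.map_rel_iff.2 hbc, fun h => hne (g.injective h).symm⟩, ?_⟩
    exact edgeType_eq_iff.2 ⟨g, hg, rfl, rfl⟩
  · rintro ⟨c, ⟨hc, hne⟩, rfl⟩
    exact ⟨a, b, c, hab, hc, fun h => hne h.symm, rfl, rfl⟩

lemma setOf_follows_left {b c : V} (hbc : G.Adj b c) :
    {s | Follows Γ s (edgeType Γ b c)} = (fun a => edgeType Γ a b) '' (G.neighborSet b \ {c}) := by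
  ext t
  constructor
  · rintro ⟨a', b', c', hab, -, hne, rfl, hs⟩
    obtain ⟨g, hg, rfl, rfl⟩ := edgeType_eq_iff.1 hs
    refine ⟨g a', ⟨g.map_rel_iff.2 hab.symm, fun h => hne (g.injective h)⟩, ?_⟩
    exact edgeType_eq_iff.2 ⟨g, hg, rfl, rfl⟩
  · rintro ⟨a, ⟨ha, hne⟩, rfl⟩
    exact ⟨a, b, c, SimpleGraph.Adj.symm ha, hbc, hne, rfl, rfl⟩

lemma ncard_neighborSet_diff [G.LocallyFinite] {q : ℕ} (hreg : G.IsRegularOfDegree (q + 1))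
    {a b : V} (hab : G.Adj b a) : (G.neighborSet b \ {a}).ncard = q := by
  rw [Set.ncard_sdiff_singleton_of_mem (show a ∈ G.neighborSet b from hab),
    Set.ncard_eq_toFinset_card', ← SimpleGraph.neighborFinset,
    SimpleGraph.card_neighborFinset_eq_degree, hreg b]
  rfl

/-- Freeness enters here: an element identifying two edges out of `b` fixes `b`, hence is trivial,
so distinct continuations have distinct types. -/
lemma ncard_follows [G.LocallyFinite] {q : ℕ} (hreg : G.IsRegularOfDegree (q + 1))
    (hfree : ∀ g ∈ Γ, g ≠ 1 → ∀ v : V, g v ≠ v) {a b : V} (hab : G.Adj a b) :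
    {t | Follows Γ (edgeType Γ a b) t}.ncard = q := by
  rw [setOf_follows hab, Set.InjOn.ncard_image, ncard_neighborSet_diff hreg hab.symm]
  intro c _ c' _ h
  obtain ⟨g, hg, hb, hc⟩ := edgeType_eq_iff.1 h
  obtain rfl : g = 1 := by_contra fun hne => hfree g hg hne b hb
  exact hc.symm

lemma ncard_follows_left [G.LocallyFinite] {q : ℕ} (hreg : G.IsRegularOfDegree (q + 1))
    (hfree : ∀ g ∈ Γ, g ≠ 1 → ∀ v : V, g v ≠ v) {b c : V} (hbc : G.Adj b c) :
    {s | Follows Γ s (edgeType Γ b c)}.ncard = q := by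
  rw [setOf_follows_left hbc, Set.InjOn.ncard_image, ncard_neighborSet_diff hreg hbc]
  intro a _ a' _ h
  obtain ⟨g, hg, ha, hb⟩ := edgeType_eq_iff.1 h
  obtain rfl : g = 1 := by_contra fun hne => hfree g hg hne b hb
  exact ha.symm

lemma Follows.mem_right {s t : MulAction.orbitRel.Quotient Γ (V × V)} (h : Follows Γ s t) :
    t ∈ edgeTypes Γ := by
  obtain ⟨a, b, c, -, hbc, -, -, rfl⟩ := h
  exact ⟨b, c, hbc, rfl⟩

/-- The types that can be reached from a type are those from which it can be reached. -/
lemma StepsTo.exists_return [G.LocallyFinite] {q : ℕ} (hreg : G.IsRegularOfDegree (q + 1))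
    (hΓ : IsFreeUniformLattice G Γ) {n : ℕ} {s t : MulAction.orbitRel.Quotient Γ (V × V)}
    (hs : s ∈ edgeTypes Γ) (h : StepsTo (Follows Γ) n s t) :
    ∃ m, StepsTo (Follows Γ) m t s := by
  have hfin := finite_edgeTypes Γ hΓ.cocompact
  have ht : t ∈ edgeTypes Γ := by
    cases n with
    | zero => exact h ▸ hs
    | succ n =>
      obtain ⟨r, -, hr⟩ := h
      exact hr.mem_right
  set A := {r | ∃ m, StepsTo (Follows Γ) m t r} with hA
  have hAE : A ⊆ edgeTypes Γ := by
    rintro r ⟨m, hm⟩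
    cases m with
    | zero => exact hm ▸ ht
    | succ m =>
      obtain ⟨p, -, hp⟩ := hm
      exact hp.mem_right
  -- The set `A` reachable from `t` is finite and closed under successors, hence by counting also
  -- under predecessors; following the given path backwards from `t` then reaches `s`.
  have hback : ∀ a b, b ∈ A → Follows Γ a b → a ∈ A := by
    intro a b hb hab
    refine mem_of_closed_of_card_eq (R := Follows Γ) (q := q) (hfin.subset hAE) ?_ ?_ ?_ ?_ hb hab
    · rintro a ⟨m, hm⟩ b hab
      exact ⟨m + 1, a, hm, hab⟩
    · intro a ha
      obtain ⟨x, y, hxy, rfl⟩ := hAE ha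
      exact ncard_follows hreg hΓ.free_vertex hxy
    · intro b hb
      refine hfin.subset ?_
      rintro _ ⟨x, y, z, hxy, -, -, rfl, -⟩
      exact ⟨x, y, hxy, rfl⟩
    · intro b hb
      obtain ⟨x, y, hxy, rfl⟩ := hAE hb
      exact ncard_follows_left hreg hΓ.free_vertex hxy
  have key : ∀ (n : ℕ) (r), r ∈ A → StepsTo (Follows Γ) n s r → s ∈ A := by
    intro n
    induction n with
    | zero => exact fun r hr h => h ▸ hr
    | succ n ih =>
      rintro r hr ⟨p, hp, hpr⟩
      exact ih p (hback p r hr hpr) hp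
  exact key n t ⟨0, rfl⟩ h

/-- A vertex has, at distance `n`, descendants of all types reached in `n` steps. -/
lemma exists_descendant (hG : G.IsTree) {O p v : V} (hpv : G.Adj p v)
    (hd : G.dist O v = G.dist O p + 1) {n : ℕ} {t : MulAction.orbitRel.Quotient Γ (V × V)}
    (h : StepsTo (Follows Γ) n (edgeType Γ p v) t) :
    ∃ p' v', G.Adj p' v' ∧ G.dist O v' = G.dist O p' + 1 ∧ G.dist O v' = G.dist O v + n ∧
      shadow G O v' ⊆ shadow G O v ∧ t = edgeType Γ p' v' := by
  induction n generalizing t with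
  | zero => exact ⟨p, v, hpv, hd, rfl, subset_rfl, h.symm⟩
  | succ n ih =>
    obtain ⟨r, hr, hrt⟩ := h
    obtain ⟨p', v', hadj, hd', hdn, hsub, rfl⟩ := ih hr
    have : t ∈ {t | Follows Γ (edgeType Γ p' v') t} := hrt
    rw [setOf_follows hadj] at this
    obtain ⟨c, ⟨hc, hne⟩, rfl⟩ := this
    -- Not backtracking means avoiding the parent `p'`, so the continuation moves away from `O`.
    have hdc : G.dist O c = G.dist O v' + 1 := by
      rcases hG.dist_eq_dist_add_one_of_adj O hc with h | h
      · exact absurd (parent_unique hG (SimpleGraph.Adj.symm hc) hadj h hd') hne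
      · exact h
    refine ⟨v', c, hc, hdc, by omega, Set.Subset.trans (fun ω hω => ?_) hsub, rfl⟩
    obtain ⟨x, rfl, hx⟩ := exists_ray_of_mem hω
    rw [Ray.mem_shadow hG hx] at hω ⊢
    have h1 := x.adj (G.dist O v')
    rw [← hdc, hω] at h1
    exact parent_unique hG (O := O) h1 hc (by rw [x.dist_base hx, hdc]) hdc

/-- The type of the last edge of the geodesic `[O, v]` is reached from the type of the first. -/
lemma exists_stepsTo_of_dist (hG : G.IsTree) {O p v : V} {n : ℕ} (hpv : G.Adj p v)
    (hp : G.dist O p = n) (hv : G.dist O v = n + 1) :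
    ∃ w, G.Adj O w ∧ StepsTo (Follows Γ) n (edgeType Γ O w) (edgeType Γ p v) := by
  induction n generalizing p v with
  | zero =>
    obtain rfl := hG.connected.dist_eq_zero_iff.1 hp
    exact ⟨v, hpv, rfl⟩
  | succ n ih =>
    obtain ⟨r, hr, hrd⟩ := exists_parent hG hp
    obtain ⟨w, hw, hs⟩ := ih hr hrd hp
    refine ⟨w, hw, _, hs, r, p, v, hr, hpv, ?_, rfl, rfl⟩
    rintro rfl
    omega

/-- The edges leading to two vertices at the same distance from `O` have continuations of equal
length and type. -/
lemma exists_common_stepsTo [G.LocallyFinite] {q : ℕ} (hq : 2 ≤ q)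
    (hreg : G.IsRegularOfDegree (q + 1)) (hG : G.IsTree) (hΓ : IsFreeUniformLattice G Γ)
    {O p v p' v' : V} {n : ℕ} (hpv : G.Adj p v) (hp : G.dist O p = n) (hv : G.dist O v = n + 1)
    (hpv' : G.Adj p' v') (hp' : G.dist O p' = n) (hv' : G.dist O v' = n + 1) :
    ∃ k t, StepsTo (Follows Γ) k (edgeType Γ p v) t ∧
      StepsTo (Follows Γ) k (edgeType Γ p' v') t := by
  classical
  obtain ⟨w, hw, hs⟩ := exists_stepsTo_of_dist (Γ := Γ) hG hpv hp hv
  obtain ⟨w', hw', hs'⟩ := exists_stepsTo_of_dist (Γ := Γ) hG hpv' hp' hv'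
  -- As `O` has at least three neighbours, one edge `(u, O)` can precede both geodesics without
  -- backtracking.
  obtain ⟨u, hu, hne⟩ : ∃ u ∈ G.neighborFinset O, u ∉ ({w, w'} : Finset V) := by
    refine Finset.exists_mem_notMem_of_card_lt_card ?_
    rw [SimpleGraph.card_neighborFinset_eq_degree, hreg O]
    exact (Finset.card_le_two).trans_lt (by omega)
  rw [SimpleGraph.mem_neighborFinset] at hu
  simp only [Finset.mem_insert, Finset.mem_singleton, not_or] at hne
  have hmem : edgeType Γ u O ∈ edgeTypes Γ := ⟨u, O, hu.symm, rfl⟩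
  have h1 := (StepsTo.single (R := Follows Γ) ⟨u, O, w, hu.symm, hw, hne.1, rfl, rfl⟩).trans hs
  have h2 := (StepsTo.single (R := Follows Γ) ⟨u, O, w', hu.symm, hw', hne.2, rfl, rfl⟩).trans hs'
  obtain ⟨r, hr⟩ := h1.exists_return hreg hΓ hmem
  obtain ⟨r', hr'⟩ := h2.exists_return hreg hΓ hmem
  -- From each end, return to `(u, O)`, go out to the other end and return from there. The two
  -- routes use the same three lengths in opposite orders.
  refine ⟨r + (1 + n) + r', edgeType Γ u O, (hr.trans h2).trans hr', ?_⟩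
  have := (hr'.trans h1).trans hr
  rwa [show r' + (1 + n) + r = r + (1 + n) + r' by ring] at this

/-- The length in `exists_common_stepsTo` can be bounded independently of the vertices. -/
lemma exists_bound_common_stepsTo [G.LocallyFinite] (hΓ : IsFreeUniformLattice G Γ) :
    ∃ K, ∀ s ∈ edgeTypes Γ, ∀ t ∈ edgeTypes Γ,
      (∃ k r, StepsTo (Follows Γ) k s r ∧ StepsTo (Follows Γ) k t r) →
      ∃ k ≤ K, ∃ r, StepsTo (Follows Γ) k s r ∧ StepsTo (Follows Γ) k t r := by
  have hfin := finite_edgeTypes Γ hΓ.cocompact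
  -- The least common length, bounded over the finitely many pairs of types; pairs without one get
  -- the harmless default `sInf ∅ = 0`.
  let f : (MulAction.orbitRel.Quotient Γ (V × V)) × (MulAction.orbitRel.Quotient Γ (V × V)) → ℕ :=
    fun p => sInf {k | ∃ r, StepsTo (Follows Γ) k p.1 r ∧ StepsTo (Follows Γ) k p.2 r}
  obtain ⟨K, hK⟩ := ((hfin.prod hfin).image f).bddAbove
  refine ⟨K, fun s hs t ht h => ⟨f (s, t), hK ⟨(s, t), ⟨hs, ht⟩, rfl⟩, ?_⟩⟩
  exact Nat.sInf_mem (s := {k | ∃ r, StepsTo (Follows Γ) k s r ∧ StepsTo (Follows Γ) k t r}) h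

end EdgeTypes

/-! ### Ergodicity of the measure preserving part -/

section Ergodicity

variable {V : Type u} {G : SimpleGraph V} [G.LocallyFinite] {q : ℕ}

lemma measureReal_shadow_eq_pow_mul (hG : G.IsTree) (hq : q ≠ 0)
    (hreg : G.IsRegularOfDegree (q + 1)) {O v w : V} (hv : v ≠ O) {k : ℕ}
    (hd : G.dist O w = G.dist O v + k) :
    (boundaryMeasure hG hq hreg O).real (shadow G O v)
      = q ^ k * (boundaryMeasure hG hq hreg O).real (shadow G O w) := by
  have hv' : G.dist O v ≠ 0 := fun h => hv (hG.connected.dist_eq_zero_iff.1 h).symm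
  have hw : w ≠ O := by
    rintro rfl
    rw [SimpleGraph.dist_self] at hd
    omega
  have hq' : (q : ℝ≥0∞) ≠ 0 := by exact_mod_cast hq
  rw [measureReal_def, measureReal_def, boundaryMeasure_shadow hG hq hreg hv,
    boundaryMeasure_shadow hG hq hreg hw, hd,
    show (1 - (G.dist O v : ℤ)) = k + (1 - ((G.dist O v + k : ℕ) : ℤ)) by push_cast; ring,
    ENNReal.zpow_add hq' (ENNReal.natCast_ne_top q), ENNReal.toReal_mul, zpow_natCast,
    ENNReal.toReal_pow, ENNReal.toReal_natCast]

/-- The measure preserving part of the full group acts ergodically. -/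
lemma measure_eq_zero_or_of_invariant (hG : G.IsTree) (hq : 2 ≤ q) (hq0 : q ≠ 0)
    (hreg : G.IsRegularOfDegree (q + 1)) {Γ : Subgroup (G ≃g G)}
    (hΓ : IsFreeUniformLattice G Γ) {O : V} {s : Set (Boundary G O)} (hs : MeasurableSet s)
    (hinv : ∀ T ∈ measurePreservingFullGroup Γ (boundaryMeasure hG hq0 hreg O),
      T ⁻¹' s =ᵐ[boundaryMeasure hG hq0 hreg O] s) :
    boundaryMeasure hG hq0 hreg O s = 0 ∨ boundaryMeasure hG hq0 hreg O sᶜ = 0 := by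
  have := isFiniteMeasure_boundaryMeasure hG hq0 hreg O
  by_contra! hcon
  obtain ⟨K, hK⟩ := exists_bound_common_stepsTo hΓ
  have hq1 : (1 : ℝ) ≤ q := by exact_mod_cast (by omega : 1 ≤ q)
  -- Passing to a descendant `k ≤ K` levels down multiplies an exceptional proportion by at most `q
  -- ^ k`, so it stays below one half.
  set ε : ℝ := 1 / (2 * q ^ K) with hε
  have hεpos : 0 < ε := by positivity
  obtain ⟨n₁, h₁⟩ := exists_measure_diff_lt hG hq0 hreg hs hcon.1 hεpos
  obtain ⟨n₂, h₂⟩ := exists_measure_diff_lt hG hq0 hreg hs.compl hcon.2 hεpos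
  -- Both vertices are taken in one sphere; the `+ 1` ensures that they have parents.
  obtain ⟨v, hv, hvs⟩ := h₁ (max n₁ n₂ + 1) (by omega)
  obtain ⟨w, hw, hws⟩ := h₂ (max n₁ n₂ + 1) (by omega)
  obtain ⟨p, hpv, hp⟩ := exists_parent hG hv
  obtain ⟨p', hpw, hp'⟩ := exists_parent hG hw
  obtain ⟨k, hk, t, hkv, hkw⟩ := hK _ ⟨p, v, hpv, rfl⟩ _ ⟨p', w, hpw, rfl⟩
    (exists_common_stepsTo hq hreg hG hΓ hpv hp hv hpw hp' hw)
  obtain ⟨a, v', hav, hda, hdv, hsv, hta⟩ := exists_descendant hG (O := O) hpv (by omega) hkv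
  obtain ⟨b, w', hbw, hdb, hdw, hsw, htb⟩ := exists_descendant hG (O := O) hpw (by omega) hkw
  obtain ⟨g, hg, hgb, hgw⟩ := edgeType_eq_iff.1 (hta.symm.trans htb)
  have hmatch : Matches O g w' v' := by
    refine ⟨by omega, hgw, b, hbw, hdb, ?_⟩
    rw [hgb, hda]
  have heq := measure_inter_shadow_eq hG hq0 hreg hg hmatch hs hinv
  have hv0 : v ≠ O := by
    rintro rfl
    rw [SimpleGraph.dist_self] at hv
    omega
  have hw0 : w ≠ O := by
    rintro rfl
    rw [SimpleGraph.dist_self] at hw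
    omega
  have hv0' : v' ≠ O := by
    rintro rfl
    rw [SimpleGraph.dist_self] at hdv
    omega
  rw [measureReal_shadow_eq_pow_mul hG hq0 hreg hv0 hdv] at hvs
  rw [measureReal_shadow_eq_pow_mul hG hq0 hreg hw0 hdw] at hws
  have hvw := measureReal_shadow_eq_pow_mul hG hq0 hreg hv0' (w := w') (k := 0) (by omega)
  rw [pow_zero, one_mul] at hvw
  set μ := boundaryMeasure hG hq0 hreg O
  have hpos : 0 < μ.real (shadow G O v') :=
    ENNReal.toReal_pos (boundaryMeasure_shadow_ne_zero hG hq0 hreg hv0') (measure_ne_top _ _)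
  -- More than half of `Ω_{v'}` lies in `s` but less than half of `Ω_{w'}`, although both the
  -- shadows and their parts in `s` have equal measure.
  have e1 : μ.real (shadow G O v' \ s) ≤ μ.real (shadow G O v \ s) :=
    measureReal_mono (Set.sdiff_subset_sdiff_left hsv)
  have e2 : μ.real (s ∩ shadow G O w') ≤ μ.real (shadow G O w \ sᶜ) := by
    rw [Set.sdiff_compl, Set.inter_comm]
    exact measureReal_mono (Set.inter_subset_inter_left _ hsw)
  have e3 : μ.real (s ∩ shadow G O w') = μ.real (s ∩ shadow G O v') := by
    rw [measureReal_def, heq, measureReal_def]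
  have e4 := measureReal_inter_add_sdiff (μ := μ) (s := shadow G O v') hs
  rw [Set.inter_comm] at e4
  have e5 : ε * q ^ k ≤ 1 / 2 := by
    have : (q : ℝ) ^ k ≤ q ^ K := pow_le_pow_right₀ hq1 hk
    rw [hε, div_mul_eq_mul_div, one_mul, div_le_div_iff₀ (by positivity) (by norm_num)]
    linarith
  have e6 := mul_le_mul_of_nonneg_right e5 hpos.le
  rw [← hvw, ← mul_assoc] at hws
  rw [← mul_assoc] at hvs
  linarith

end Ergodicity
end TreeBoundary

theorem mainTheorem4 {V : Type*} (Δ : SimpleGraph V) [Δ.LocallyFinite] (hΔ : Δ.IsTree)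
    (q : ℕ) (hq : 2 ≤ q) (hreg : Δ.IsRegularOfDegree (q + 1))
    (Γ : Subgroup (Δ ≃g Δ)) (hΓ : TreeBoundary.IsFreeUniformLattice Δ Γ) (O : V) :
    ∃ H : Subgroup (Equiv.Perm (TreeBoundary.Boundary Δ O)),
      H ≤ TreeBoundary.fullGroup Γ
        (TreeBoundary.boundaryMeasure hΔ (by omega : q ≠ 0) hreg O) ∧
      (∀ h ∈ H, MeasureTheory.MeasurePreserving h
        (TreeBoundary.boundaryMeasure hΔ (by omega : q ≠ 0) hreg O)
        (TreeBoundary.boundaryMeasure hΔ (by omega : q ≠ 0) hreg O)) ∧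
      ErgodicSMul H (TreeBoundary.Boundary Δ O)
        (TreeBoundary.boundaryMeasure hΔ (by omega : q ≠ 0) hreg O) := by
  refine ⟨TreeBoundary.measurePreservingFullGroup Γ _, fun h hh => hh.1, fun h hh => hh.2.1,
    { measure_preimage_smul := fun h _ hs =>
        h.2.2.1.measure_preimage hs.nullMeasurableSet
      aeconst_of_forall_preimage_smul_ae_eq := fun hs hinv => ?_ }⟩
  rw [Filter.eventuallyConst_set']
  rcases TreeBoundary.measure_eq_zero_or_of_invariant hΔ hq _ hreg hΓ hs
    fun T hT => hinv ⟨T, hT⟩ with h | h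
  · exact Or.inl (ae_eq_empty.2 h)
  · exact Or.inr (ae_eq_univ.2 h)
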